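/- Let $n\ge 1$ and $1\le p<\infty$. Cubes are cubes $Q\subset\mathbb R^n$ with sides parallel to the axes, $|E|$ is Lebesgue measure, and $\langle f\rangle_Q=|Q|^{-1}\int_Q f$. A dyadic grid $\mathcal D$ is a family of half-open cubes with side lengths $2^k$, $k\in\mathbb Z$, any two of which are nested or disjoint, and such that for each $k\in\mathbb Z$ the cubes in $\mathcal D$ of side length $2^k$ partition $\mathbb R^n$. A subset $\mathcal S\subset\mathcal D$ is sparse if for every $Q\in\mathcal S$ there is a measurable set $E_Q\subset Q$ with $|Q|\le 2|E_Q|$, the sets $E_Q$ being pairwise disjoint; put $A_{\mathcal S}f=\sum_{Q\in\mathcal S}\langle f\rangle_Q\chi_Q$. A weight is a locally integrable function $w$ on $\mathbb R^n$ with $w>0$ a.e.; $w\in A_p$ means $[w]_{A_p}<\infty$, where, with suprema over all cubes $Q$, $$[w]_{A_p}=\sup_Q\,\langle w\rangle_Q\,\langle w^{1-p'}\rangle_Q^{\,p-1}\quad(1<p<\infty,\ p'=\tfrac{p}{p-1}),\qquad [w]_{A_1}=\sup_Q\,\operatorname*{ess\,sup}_{x\in Q}w(x)^{-1}\,\langle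 w\rangle_Q .$$ Let $[w]_{A_\infty}=\sup_Q w(Q)^{-1}\int_Q M(w\chi_Q)\,dx$ be the Fujii–Wilson characteristic, where $w(Q)=\int_Q w$ and $Mf(x)=\sup_{Q\ni x}\langle |f|\rangle_Q$. **Theorem 3.1.** There is a constant $C=C(n,p)<\infty$ such that for every dyadic grid $\mathcal D$, every sparse $\mathcal S\subset\mathcal D$, every weight $w\in A_p$ and every real-valued $f\in L^p(\mathbb R^n)$, the function $fw^{-1/p}$ is locally integrable, the sum defining $A_{\mathcal S}(fw^{-1/p})(x)$ converges absolutely for a.e. $x$, and for every $\lambda>0$ $$\bigl|\{x\in\mathbb R^n:\ |w(x)^{1/p}A_{\mathcal S}(fw^{-1/p})(x)|>\lambda\}\bigr|\le C\,[w]_{A_p}\,[w]_{A_\infty}^{p}\Bigl(\frac{\|f\|_{L^p}}{\lambda}\Bigr)^{p}.$$ -/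

import Mathlib

open MeasureTheory Set
open scoped ENNReal NNReal

noncomputable section

namespace SparseWeak

/-- The half-open cube `∏ᵢ [aᵢ, aᵢ + l)` in `ℝⁿ` with sides parallel to the axes
(used with side length `l > 0`). -/
def cube {n : ℕ} (a : Fin n → ℝ) (l : ℝ) : Set (Fin n → ℝ) :=
  Set.univ.pi fun i => Set.Ico (a i) (a i + l)

/-- A dyadic grid: a family of half-open cubes whose side lengths are powers of two, any two of
which are nested or disjoint, and whose members of side length `2 ^ k` partition `ℝⁿ`, for
every integer `k`. -/
structure IsDyadicGrid {n : ℕ} (D : Set (Set (Fin n → ℝ))) : Prop where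
  isCube : ∀ Q ∈ D, ∃ (a : Fin n → ℝ) (k : ℤ), Q = cube a ((2 : ℝ) ^ k)
  nested : ∀ P ∈ D, ∀ Q ∈ D, P ∩ Q = P ∨ P ∩ Q = Q ∨ P ∩ Q = ∅
  partition : ∀ k : ℤ,
    Setoid.IsPartition {Q | Q ∈ D ∧ ∃ a : Fin n → ℝ, Q = cube a ((2 : ℝ) ^ k)}

/-- A family of sets is sparse: every member `Q` contains a measurable set `E Q` with
`|Q| ≤ 2 |E Q|`, and the sets `E Q` are pairwise disjoint. -/
def IsSparse {n : ℕ} (S : Set (Set (Fin n → ℝ))) : Prop :=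
  ∃ E : Set (Fin n → ℝ) → Set (Fin n → ℝ),
    (∀ Q ∈ S, MeasurableSet (E Q) ∧ E Q ⊆ Q ∧ volume Q ≤ 2 * volume (E Q)) ∧
    S.PairwiseDisjoint E

/-- The sparse operator `A_S f (x) = ∑_{Q ∈ S} ⟨f⟩_Q χ_Q(x)`. -/
def sparseOp {n : ℕ} (S : Set (Set (Fin n → ℝ))) (f : (Fin n → ℝ) → ℝ) (x : Fin n → ℝ) : ℝ :=
  ∑' Q : S, (Q : Set (Fin n → ℝ)).indicator (fun _ => ⨍ y in (Q : Set (Fin n → ℝ)), f y) x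

/-- The (uncentered) Hardy-Littlewood maximal function over cubes. -/
def maximalFn {n : ℕ} (f : (Fin n → ℝ) → ℝ) (x : Fin n → ℝ) : ℝ≥0∞ :=
  ⨆ (a : Fin n → ℝ) (l : ℝ) (_ : 0 < l) (_ : x ∈ cube a l), ⨍⁻ y in cube a l, ‖f y‖ₑ ∂volume

/-- A scalar weight: a locally integrable function that is positive almost everywhere. -/
def IsWeight {n : ℕ} (w : (Fin n → ℝ) → ℝ) : Prop :=
  LocallyIntegrable w volume ∧ ∀ᵐ x, 0 < w x

/-- The Muckenhoupt characteristic `[w]_{A_p}` for `1 ≤ p < ∞`, the supremum being over all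
cubes; here `Real.conjExponent p = p / (p - 1)` is the exponent `p'`. -/
def apConst {n : ℕ} (p : ℝ) (w : (Fin n → ℝ) → ℝ) : ℝ≥0∞ :=
  if p = 1 then
    ⨆ (a : Fin n → ℝ) (l : ℝ) (_ : 0 < l),
      essSup (fun x => (ENNReal.ofReal (w x))⁻¹) (volume.restrict (cube a l)) *
        ⨍⁻ x in cube a l, ENNReal.ofReal (w x) ∂volume
  else
    ⨆ (a : Fin n → ℝ) (l : ℝ) (_ : 0 < l),
      (⨍⁻ x in cube a l, ENNReal.ofReal (w x) ∂volume) *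
        (⨍⁻ x in cube a l, ENNReal.ofReal (w x) ^ (1 - p.conjExponent) ∂volume) ^ (p - 1)

/-- The class `A_p`. -/
def MemAp {n : ℕ} (p : ℝ) (w : (Fin n → ℝ) → ℝ) : Prop :=
  IsWeight w ∧ apConst p w < ∞

/-- The Fujii-Wilson characteristic `[w]_{A_∞} = sup_Q w(Q)⁻¹ ∫_Q M(w χ_Q)`. -/
def ainftyConst {n : ℕ} (w : (Fin n → ℝ) → ℝ) : ℝ≥0∞ :=
  ⨆ (a : Fin n → ℝ) (l : ℝ) (_ : 0 < l),
    (∫⁻ x in cube a l, maximalFn ((cube a l).indicator w) x) /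
      ∫⁻ x in cube a l, ENNReal.ofReal (w x)

end SparseWeak

end

open MeasureTheory Set
open scoped ENNReal NNReal

noncomputable section

namespace SparseWeak

open Filter Topology

variable {n : ℕ}

/-! ### Cubes -/

/-! Put `g = f w^{-1/p}`. Hölder and the `A_p` condition give `⟨w⟩_Q ⟨|g|⟩_Q^p ≤ [w]_{A_p} ⟨|g|^p
w⟩_Q` (`setLAverage_mul_rpow_le_apConst`). With `a_Q = ⟨|g|⟩_Q / λ` and `H = [w]_{A_p} λ^{-p} |g|^p
w` this reads `⟨w⟩_Q a_Q^p ≤ ⟨H⟩_Q`, while `∫ H = [w]_{A_p} (‖f‖_p / λ)^p`. It remains to bound the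
measure of `{w^{1/p} ∑ a_Q χ_Q > 1}` by a multiple of `[w]_{A_∞}^p ∫ H` (`volume_lt_sum_le`).

Cubes with `⟨H⟩_Q > 1` cover a set of measure at most `∫ H`. The others are sorted into layers
`⟨H⟩_Q ≈ 2^{-j}` and estimated in `L^q` with `q = p(1+ε)`. By the reverse Hölder inequality, the
`q`-th power of `a_Q w^{1/p} χ_Q` has integral at most `2 · 2^{-j(1+ε)} |Q|`. Sparseness lets these
functions be added within a layer almost as if they were disjoint
(`lintegral_sum_rpow_le_of_sparse`), and `∑ |Q|` is at most a multiple of `2^j ∫ H`, so a factor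
`2^{-jε}` survives (`lintegral_layer_le`). Summing the norms over `j` costs about `q/ε`. With `ε =
1/(4(n+1)[w]_{A_∞})`, Chebyshev yields `[w]_{A_∞}^{p(1+ε)}`, and the surplus power is bounded.

The reverse Hölder inequality comes from an induction over dyadic scales
(`lintegral_gridAvg_rpow_le_truncated`), followed by Lebesgue differentiation and Fatou. Almost
everywhere convergence is separate: almost every point lies in finitely many small sparse cubes, and
along the large cubes `w(Q)` grows geometrically, so the averages of `|g|` decay geometrically. -/

theorem measurableSet_cube (a : Fin n → ℝ) (l : ℝ) : MeasurableSet (cube a l) :=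
  MeasurableSet.univ_pi fun _ => measurableSet_Ico

theorem volume_cube (a : Fin n → ℝ) (l : ℝ) : volume (cube a l) = ENNReal.ofReal l ^ n := by
  rw [cube, Real.volume_pi_Ico]
  simp

theorem cube_subset_closedBall (a : Fin n → ℝ) {l : ℝ} (hl : 0 ≤ l) :
    cube a l ⊆ Metric.closedBall a l := by
  intro x hx
  rw [Metric.mem_closedBall, dist_pi_le_iff hl]
  intro i
  have := hx i (mem_univ i)
  rw [Real.dist_eq, abs_le]
  constructor <;> linarith [this.1, this.2]

/-- Closed balls of the sup metric are closed cubes, so differentiation theorems stated for balls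
apply to half-open cubes. -/
theorem cube_ae_eq_closedBall (a : Fin n → ℝ) {l : ℝ} (hl : 0 ≤ l) :
    cube a l =ᵐ[volume] Metric.closedBall (fun i => a i + l / 2) (l / 2) := by
  have h : Metric.closedBall (fun i => a i + l / 2) (l / 2)
      = Set.univ.pi fun i => Icc (a i) (a i + l) := by
    rw [closedBall_pi _ (by positivity)]
    congr 1
    funext i
    rw [Real.closedBall_eq_Icc]
    congr 1 <;> ring
  rw [h, pi_univ_Icc]
  exact Measure.univ_pi_Ico_ae_eq_Icc

theorem cube_subset_closedBall_center (a : Fin n → ℝ) {l : ℝ} (hl : 0 ≤ l) :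
    cube a l ⊆ Metric.closedBall (fun i => a i + l / 2) (l / 2) := by
  intro x hx
  rw [Metric.mem_closedBall, dist_pi_le_iff (by positivity)]
  intro i
  have := hx i (mem_univ i)
  rw [Real.dist_eq, abs_le]
  constructor <;> linarith [this.1, this.2]

theorem interior_cube_nonempty (a : Fin n → ℝ) {l : ℝ} (hl : 0 < l) :
    (interior (cube a l)).Nonempty := by
  refine ⟨fun i => a i + l / 2, ?_⟩
  rw [cube, interior_pi_set Set.finite_univ]
  intro i _
  simp only [interior_Ico, mem_Ioo]
  constructor <;> linarith

theorem volume_cube_ne_zero (a : Fin n → ℝ) {l : ℝ} (hl : 0 < l) : volume (cube a l) ≠ 0 := by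
  rw [volume_cube]
  exact pow_ne_zero _ (by simpa using hl)

theorem volume_cube_ne_top (a : Fin n → ℝ) (l : ℝ) : volume (cube a l) ≠ ∞ := by
  rw [volume_cube]
  exact ENNReal.pow_ne_top ENNReal.ofReal_ne_top

theorem lintegral_cube_enorm_lt_top {w : (Fin n → ℝ) → ℝ} (hw : LocallyIntegrable w volume)
    (a : Fin n → ℝ) {l : ℝ} (hl : 0 ≤ l) : ∫⁻ x in cube a l, ‖w x‖ₑ < ∞ :=
  ((hw.integrableOn_isCompact (isCompact_closedBall a l)).mono_set
    (cube_subset_closedBall a hl)).2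

theorem lintegral_cube_ofReal_lt_top {w : (Fin n → ℝ) → ℝ} (hw : LocallyIntegrable w volume)
    (a : Fin n → ℝ) {l : ℝ} (hl : 0 ≤ l) : ∫⁻ x in cube a l, ENNReal.ofReal (w x) < ∞ :=
  (lintegral_mono fun x => Real.ofReal_le_enorm (w x)).trans_lt
    (lintegral_cube_enorm_lt_top hw a hl)

theorem setLAverage_mul_volume {f : (Fin n → ℝ) → ℝ≥0∞} {Q : Set (Fin n → ℝ)}
    (h0 : volume Q ≠ 0) (ht : volume Q ≠ ∞) :
    (⨍⁻ x in Q, f x ∂volume) * volume Q = ∫⁻ x in Q, f x := by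
  rw [setLAverage_eq, ENNReal.div_mul_cancel h0 ht]

/-! ### Dyadic grids -/

/-- The cubes of side length `2 ^ k` of the family `D`. -/
def level (D : Set (Set (Fin n → ℝ))) (k : ℤ) : Set (Set (Fin n → ℝ)) :=
  {Q | Q ∈ D ∧ ∃ a : Fin n → ℝ, Q = cube a ((2 : ℝ) ^ k)}

variable {D : Set (Set (Fin n → ℝ))}

theorem two_zpow_pos (k : ℤ) : (0 : ℝ) < (2 : ℝ) ^ k := by positivity

theorem volume_of_mem_level {k : ℤ} {Q : Set (Fin n → ℝ)} (hQ : Q ∈ level D k) :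
    volume Q = ENNReal.ofReal ((2 : ℝ) ^ k) ^ n := by
  obtain ⟨-, a, rfl⟩ := hQ
  exact volume_cube a _

theorem volume_ne_zero_of_mem_level {k : ℤ} {Q : Set (Fin n → ℝ)} (hQ : Q ∈ level D k) :
    volume Q ≠ 0 := by
  obtain ⟨-, a, rfl⟩ := hQ
  exact volume_cube_ne_zero a (two_zpow_pos k)

theorem volume_ne_top_of_mem_level {k : ℤ} {Q : Set (Fin n → ℝ)} (hQ : Q ∈ level D k) :
    volume Q ≠ ∞ := by
  obtain ⟨-, a, rfl⟩ := hQ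
  exact volume_cube_ne_top a _

theorem measurableSet_of_mem_level {k : ℤ} {Q : Set (Fin n → ℝ)} (hQ : Q ∈ level D k) :
    MeasurableSet Q := by
  obtain ⟨-, a, rfl⟩ := hQ
  exact measurableSet_cube a _

theorem volume_level_succ {k : ℤ} {P Q : Set (Fin n → ℝ)} (hP : P ∈ level D (k + 1))
    (hQ : Q ∈ level D k) : volume P = 2 ^ n * volume Q := by
  rw [volume_of_mem_level hP, volume_of_mem_level hQ, ← mul_pow, zpow_add_one₀ two_ne_zero,
    mul_comm, ENNReal.ofReal_mul two_pos.le]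
  simp

namespace IsDyadicGrid

theorem exists_mem_level (hD : IsDyadicGrid D) {Q : Set (Fin n → ℝ)} (hQ : Q ∈ D) :
    ∃ k, Q ∈ level D k := by
  obtain ⟨a, k, h⟩ := hD.isCube Q hQ
  exact ⟨k, hQ, a, h⟩

theorem volume_ne_zero (hD : IsDyadicGrid D) {Q : Set (Fin n → ℝ)} (hQ : Q ∈ D) : volume Q ≠ 0 := by
  obtain ⟨k, hk⟩ := hD.exists_mem_level hQ
  exact volume_ne_zero_of_mem_level hk

theorem volume_ne_top (hD : IsDyadicGrid D) {Q : Set (Fin n → ℝ)} (hQ : Q ∈ D) : volume Q ≠ ∞ := by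
  obtain ⟨k, hk⟩ := hD.exists_mem_level hQ
  exact volume_ne_top_of_mem_level hk

theorem measurableSet (hD : IsDyadicGrid D) {Q : Set (Fin n → ℝ)}
    (hQ : Q ∈ D) : MeasurableSet Q := by
  obtain ⟨k, hk⟩ := hD.exists_mem_level hQ
  exact measurableSet_of_mem_level hk

theorem level_pairwiseDisjoint (hD : IsDyadicGrid D) (k : ℤ) : (level D k).PairwiseDisjoint id :=
  (hD.partition k).pairwiseDisjoint

theorem level_countable (hD : IsDyadicGrid D) (k : ℤ) : (level D k).Countable := by
  refine (hD.level_pairwiseDisjoint k).countable_of_nonempty_interior ?_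
  rintro Q ⟨-, a, rfl⟩
  exact interior_cube_nonempty a (two_zpow_pos k)

theorem countable (hD : IsDyadicGrid D) : D.Countable := by
  refine (Set.countable_iUnion fun k => hD.level_countable k).mono fun Q hQ => ?_
  obtain ⟨k, hk⟩ := hD.exists_mem_level hQ
  exact mem_iUnion.2 ⟨k, hk⟩

theorem exists_unique_mem_level (hD : IsDyadicGrid D) (k : ℤ) (x : Fin n → ℝ) :
    ∃! Q, Q ∈ level D k ∧ x ∈ Q :=
  (hD.partition k).2 x

theorem disjoint_or_subset (hD : IsDyadicGrid D) {P Q : Set (Fin n → ℝ)} (hP : P ∈ D) (hQ : Q ∈ D) :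
    Disjoint P Q ∨ P ⊆ Q ∨ Q ⊆ P := by
  rcases hD.nested P hP Q hQ with h | h | h
  · exact Or.inr (Or.inl (inter_eq_left.1 h))
  · exact Or.inr (Or.inr (inter_eq_right.1 h))
  · exact Or.inl (disjoint_iff_inter_eq_empty.2 h)

end IsDyadicGrid

/-- The cube of side length `2 ^ k` of a dyadic grid containing the point `x`. -/
def gridCube (hD : IsDyadicGrid D) (k : ℤ) (x : Fin n → ℝ) : Set (Fin n → ℝ) :=
  (hD.exists_unique_mem_level k x).choose

namespace IsDyadicGrid

theorem gridCube_mem_level (hD : IsDyadicGrid D) (k : ℤ) (x : Fin n → ℝ) :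
    gridCube hD k x ∈ level D k :=
  (hD.exists_unique_mem_level k x).choose_spec.1.1

theorem gridCube_mem (hD : IsDyadicGrid D) (k : ℤ) (x : Fin n → ℝ) : gridCube hD k x ∈ D :=
  (hD.gridCube_mem_level k x).1

theorem mem_gridCube (hD : IsDyadicGrid D) (k : ℤ) (x : Fin n → ℝ) : x ∈ gridCube hD k x :=
  (hD.exists_unique_mem_level k x).choose_spec.1.2

theorem eq_gridCube (hD : IsDyadicGrid D) {k : ℤ} {x : Fin n → ℝ} {Q : Set (Fin n → ℝ)}
    (hQ : Q ∈ level D k)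
    (hx : x ∈ Q) : Q = gridCube hD k x :=
  (hD.exists_unique_mem_level k x).unique ⟨hQ, hx⟩
    ⟨hD.gridCube_mem_level k x, hD.mem_gridCube k x⟩

theorem gridCube_subset_succ (hD : IsDyadicGrid D) (k : ℤ) (x : Fin n → ℝ) :
    gridCube hD k x ⊆ gridCube hD (k + 1) x := by
  rcases hD.disjoint_or_subset (hD.gridCube_mem k x) (hD.gridCube_mem (k + 1) x) with h | h | h
  · exact absurd (hD.mem_gridCube (k + 1) x) (Set.disjoint_left.1 h (hD.mem_gridCube k x))
  · exact h
  · obtain ⟨-, a, ha⟩ := hD.gridCube_mem_level k x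
    obtain ⟨-, b, hb⟩ := hD.gridCube_mem_level (k + 1) x
    -- In dimension zero all cubes have the same volume, so the comparison of volumes below needs `n
    -- > 0`.
    rcases Nat.eq_zero_or_pos n with rfl | hn
    · intro y _
      rw [Subsingleton.elim y x]
      exact hD.mem_gridCube _ x
    have h1 := measure_mono (μ := volume) h
    rw [volume_level_succ (hD.gridCube_mem_level (k + 1) x) (hD.gridCube_mem_level k x)] at h1
    have h0 := hD.volume_ne_zero (hD.gridCube_mem k x)
    have ht := hD.volume_ne_top (hD.gridCube_mem k x)
    have h2 : (1 : ℝ≥0∞) * volume (gridCube hD k x) < 2 ^ n * volume (gridCube hD k x) :=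
      (ENNReal.mul_lt_mul_iff_left h0 ht).2 (one_lt_pow₀ ENNReal.one_lt_two hn.ne')
    rw [one_mul] at h2
    exact absurd h1 (not_le.2 h2)

theorem gridCube_mono (hD : IsDyadicGrid D) (x : Fin n → ℝ) : Monotone fun k => gridCube hD k x :=
  monotone_int_of_le_succ fun k => hD.gridCube_subset_succ k x

theorem lintegral_level_succ (hD : IsDyadicGrid D) {k : ℤ} {Q : Set (Fin n → ℝ)}
    (hQ : Q ∈ level D (k + 1))
    (f : (Fin n → ℝ) → ℝ≥0∞) :
    ∫⁻ x in Q, f x = ∑' c : {c // c ∈ level D k ∧ c ⊆ Q}, ∫⁻ x in (c : Set (Fin n → ℝ)), f x := by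
  have : Countable {c // c ∈ level D k ∧ c ⊆ Q} :=
    ((hD.level_countable k).mono fun c (hc : c ∈ level D k ∧ c ⊆ Q) => hc.1).to_subtype
  have hU : Q = ⋃ c : {c // c ∈ level D k ∧ c ⊆ Q}, (c : Set (Fin n → ℝ)) := by
    ext x
    refine ⟨fun hx => mem_iUnion.2 ⟨⟨gridCube hD k x, hD.gridCube_mem_level k x, ?_⟩,
      hD.mem_gridCube k x⟩, fun hx => ?_⟩
    · rw [hD.eq_gridCube hQ hx]
      exact hD.gridCube_subset_succ k x
    · obtain ⟨c, hc⟩ := mem_iUnion.1 hx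
      exact c.2.2 hc
  conv_lhs => rw [hU]
  refine lintegral_iUnion (fun c => measurableSet_of_mem_level c.2.1) ?_ f
  intro c d hcd
  exact hD.level_pairwiseDisjoint k c.2.1 d.2.1 fun h => hcd (Subtype.ext h)

end IsDyadicGrid

/-! ### The reverse Hölder inequality -/

theorem maximalFn_mono {f g : (Fin n → ℝ) → ℝ} (h : ∀ x, ‖f x‖ₑ ≤ ‖g x‖ₑ) (x : Fin n → ℝ) :
    maximalFn f x ≤ maximalFn g x := by
  unfold maximalFn
  refine iSup_mono fun a => iSup_mono fun l => iSup_mono fun _ => iSup_mono fun _ => ?_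
  rw [setLAverage_eq, setLAverage_eq]
  exact ENNReal.div_le_div_right (lintegral_mono h) _

theorem maximalFn_indicator_mono {w : (Fin n → ℝ) → ℝ} {P Q : Set (Fin n → ℝ)} (h : P ⊆ Q)
    (x : Fin n → ℝ) : maximalFn (P.indicator w) x ≤ maximalFn (Q.indicator w) x := by
  refine maximalFn_mono (fun y => ?_) x
  rw [enorm_indicator_eq_indicator_enorm, enorm_indicator_eq_indicator_enorm]
  exact indicator_le_indicator_of_subset h (fun _ => zero_le) y

theorem setLAverage_le_maximalFn {w : (Fin n → ℝ) → ℝ} {k : ℤ} {Q : Set (Fin n → ℝ)}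
    (hQ : Q ∈ level D k) {x : Fin n → ℝ} (hx : x ∈ Q) :
    ⨍⁻ y in Q, ENNReal.ofReal (w y) ∂volume ≤ maximalFn (Q.indicator w) x := by
  obtain ⟨-, a, rfl⟩ := hQ
  unfold maximalFn
  refine le_trans ?_ (le_iSup_of_le a <| le_iSup_of_le ((2 : ℝ) ^ k) <|
    le_iSup_of_le (two_zpow_pos k) <| le_iSup_of_le hx le_rfl)
  rw [setLAverage_eq, setLAverage_eq]
  refine ENNReal.div_le_div_right ?_ _
  refine setLIntegral_mono' (measurableSet_cube _ _) fun y hy => ?_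
  rw [indicator_of_mem hy]
  exact Real.ofReal_le_enorm (w y)

/-- Since `V = Z - U`, the bracket equals `(2A-1)U + 2Z`, which is at most `(4A-1)U`. Multiplying it
by `β ≤ 1 + 1/(4A)` adds at most `U`, exactly the gap to the right-hand side. This is how the loss
in each stopping step is absorbed. -/
theorem stopping_arithmetic {A β : ℝ≥0} (hβA : 4 * A * β ≤ 4 * A + 1)
    {U V Z : ℝ≥0∞} (hU : U ≠ ∞) (hVZ : V + U = Z) (hZ : Z ≤ A * U) :
    (β : ℝ≥0∞) * ((2 * A + 1) * U + 2 * V) ≤ 2 * A * U + 2 * Z := by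
  have hZt : Z ≠ ∞ := ne_top_of_le_ne_top (ENNReal.mul_ne_top ENNReal.coe_ne_top hU) hZ
  have hVt : V ≠ ∞ := ne_top_of_le_ne_top hZt (hVZ ▸ le_self_add)
  lift U to ℝ≥0 using hU
  lift V to ℝ≥0 using hVt
  lift Z to ℝ≥0 using hZt
  norm_cast at hVZ hZ ⊢
  rw [← NNReal.coe_le_coe] at *
  rw [← NNReal.coe_inj] at hVZ
  push_cast at *
  have hU := U.2
  have hA := A.2
  have hV := V.2
  rw [← hVZ] at hZ ⊢
  -- For `A = 0` the bound on `β` is empty, but all three quantities vanish.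
  by_cases hA0 : (A : ℝ) = 0
  · have h1 : (U : ℝ) = 0 := by
      have : (V : ℝ) + U ≤ 0 := by simpa [hA0] using hZ
      nlinarith [NNReal.coe_nonneg U, NNReal.coe_nonneg V]
    have h2 : (V : ℝ) = 0 := by
      have : (V : ℝ) + U ≤ 0 := by simpa [hA0] using hZ
      nlinarith [NNReal.coe_nonneg U, NNReal.coe_nonneg V]
    simp [h1, h2]
  have hA1 : 0 < (A : ℝ) := lt_of_le_of_ne hA (Ne.symm hA0)
  have h3 : 0 ≤ (2 * (A : ℝ) + 1) * U + 2 * V := by positivity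
  have h4 := mul_le_mul_of_nonneg_right hβA h3
  have h5 : 4 * (A : ℝ) * (β * ((2 * A + 1) * U + 2 * V))
      ≤ 4 * A * (2 * A * U + 2 * (V + U)) := by
    nlinarith
  exact le_of_mul_le_mul_left h5 (by positivity)

/-- The average of `f` over the cube of side length `2 ^ k` of the grid containing `x`. -/
def gridAvg (hD : IsDyadicGrid D) (k : ℤ) (f : (Fin n → ℝ) → ℝ≥0∞) (x : Fin n → ℝ) : ℝ≥0∞ :=
  ⨍⁻ y in gridCube hD k x, f y ∂volume

theorem gridAvg_of_mem (hD : IsDyadicGrid D) {k : ℤ} {f : (Fin n → ℝ) → ℝ≥0∞} {x : Fin n → ℝ}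
    {Q : Set (Fin n → ℝ)} (hQ : Q ∈ level D k) (hx : x ∈ Q) :
    gridAvg hD k f x = ⨍⁻ y in Q, f y ∂volume := by
  rw [gridAvg, ← hD.eq_gridCube hQ hx]

theorem measurable_gridAvg (hD : IsDyadicGrid D) (k : ℤ) (f : (Fin n → ℝ) → ℝ≥0∞) :
    Measurable (gridAvg hD k f) := by
  have hc : Countable (level D k) := (hD.level_countable k).to_subtype
  have h : gridAvg hD k f = fun x => ∑' Q : level D k,
      (Q : Set (Fin n → ℝ)).indicator (fun _ => ⨍⁻ y in (Q : Set (Fin n → ℝ)), f y ∂volume) x := by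
    funext x
    rw [tsum_eq_single (⟨gridCube hD k x, hD.gridCube_mem_level k x⟩ : level D k)]
    · rw [indicator_of_mem (hD.mem_gridCube k x)]
      rfl
    · intro Q hQ
      refine indicator_of_notMem (fun hx => hQ ?_) _
      exact Subtype.ext (hD.eq_gridCube Q.2 hx)
  rw [h]
  exact Measurable.tsum fun Q =>
    measurable_const.indicator (measurableSet_of_mem_level Q.2)

/-- An induction on scales replaces a stopping-time decomposition; `r` is the average at the last
stopping cube. While averages stay below `2r` the threshold is kept and the estimate is additive
over children. When a child's average `s` exceeds `2r` the threshold restarts at `s`, and the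
truncated maximal function pays for the restart. Averages at scale `2 ^ k` stand in for `w`, so the
induction has a bottom. -/
theorem lintegral_gridAvg_rpow_le_truncated (hD : IsDyadicGrid D) {w : (Fin n → ℝ) → ℝ}
    (hw : LocallyIntegrable w volume) {A β : ℝ≥0} {ε : ℝ} (hε : 0 ≤ ε)
    (hβ : ((2 : ℝ≥0∞) ^ (n + 1)) ^ ε ≤ β) (hβA : 4 * A * β ≤ 4 * A + 1)
    (hM : ∀ Q ∈ D, ∫⁻ x in Q, maximalFn (Q.indicator w) x ≤ A * ∫⁻ x in Q, ENNReal.ofReal (w x))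
    (k : ℤ) (N : ℕ) : ∀ Q ∈ level D (k + N), ∀ r : ℝ≥0∞,
      ⨍⁻ x in Q, ENNReal.ofReal (w x) ∂volume ≤ 2 * r →
      2 * A * ∫⁻ x in Q, gridAvg hD k (fun y => ENNReal.ofReal (w y)) x ^ (1 + ε) ≤
        (2 ^ (n + 1) * r) ^ ε * ((2 * A + 1) * (∫⁻ x in Q, ENNReal.ofReal (w x))
          + 2 * ∫⁻ x in Q, (maximalFn (Q.indicator w) x - r)) := by
  have hfin : ∀ {j : ℤ} {Q : Set (Fin n → ℝ)}, Q ∈ level D j →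
      ∫⁻ x in Q, ENNReal.ofReal (w x) ≠ ∞ := by
    rintro j Q ⟨-, a, rfl⟩
    exact (lintegral_cube_ofReal_lt_top hw a (two_zpow_pos j).le).ne
  induction N with
  | zero =>
    intro Q hQ r hr
    rw [Nat.cast_zero, add_zero] at hQ
    have hmeas := measurableSet_of_mem_level hQ
    set c := ⨍⁻ x in Q, ENNReal.ofReal (w x) ∂volume with hc
    have h1 : ∫⁻ x in Q, gridAvg hD k (fun y => ENNReal.ofReal (w y)) x ^ (1 + ε)
        = c ^ ε * ∫⁻ x in Q, ENNReal.ofReal (w x) := by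
      rw [setLIntegral_congr_fun (g := fun _ => c ^ (1 + ε)) hmeas
        (fun x hx => by simp only [gridAvg_of_mem hD hQ hx, ← hc]), setLIntegral_const,
        ENNReal.rpow_add_of_nonneg _ _ zero_le_one hε, ENNReal.rpow_one, mul_comm c, mul_assoc,
        hc, setLAverage_mul_volume (volume_ne_zero_of_mem_level hQ)
          (volume_ne_top_of_mem_level hQ)]
    rw [h1]
    have h2 : c ^ ε ≤ (2 ^ (n + 1) * r) ^ ε := by
      refine ENNReal.rpow_le_rpow (hr.trans ?_) hε
      gcongr
      calc (2 : ℝ≥0∞) = 2 ^ 1 := (pow_one _).symm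
        _ ≤ 2 ^ (n + 1) := pow_le_pow_right₀ one_le_two (by omega)
    calc 2 * (A : ℝ≥0∞) * (c ^ ε * ∫⁻ x in Q, ENNReal.ofReal (w x))
        = c ^ ε * (2 * A * ∫⁻ x in Q, ENNReal.ofReal (w x)) := by ring
      _ ≤ _ := by
        gcongr
        refine le_add_right ?_
        gcongr
        exact le_self_add
  | succ N ih =>
    intro Q hQ r hr
    have hQ' : Q ∈ level D (k + N + 1) := by
      rw [Nat.cast_succ, ← add_assoc] at hQ
      exact hQ
    have hchild : ∀ c ∈ level D (k + N), c ⊆ Q →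
        2 * A * ∫⁻ x in c, gridAvg hD k (fun y => ENNReal.ofReal (w y)) x ^ (1 + ε) ≤
        (2 ^ (n + 1) * r) ^ ε * ((2 * A + 1) * (∫⁻ x in c, ENNReal.ofReal (w x))
          + 2 * ∫⁻ x in c, (maximalFn (c.indicator w) x - r)) := by
      intro c hc hcQ
      rcases le_or_gt (⨍⁻ x in c, ENNReal.ofReal (w x) ∂volume) (2 * r) with h | h
      · exact ih c hc r h
      have hmeas := measurableSet_of_mem_level hc
      have hv0 := volume_ne_zero_of_mem_level hc
      have hvt := volume_ne_top_of_mem_level hc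
      set s := ⨍⁻ x in c, ENNReal.ofReal (w x) ∂volume with hs
      set U := ∫⁻ x in c, ENNReal.ofReal (w x) with hU
      set Z := ∫⁻ x in c, maximalFn (c.indicator w) x with hZ
      have hsU : s * volume c = U := setLAverage_mul_volume hv0 hvt
      -- A child's average is at most `2 ^ n` times its parent's, and the parent's is at most `2r`.
      have hsr : s ≤ 2 ^ (n + 1) * r := by
        have h1 : U ≤ ∫⁻ x in Q, ENNReal.ofReal (w x) := lintegral_mono_set hcQ
        rw [← setLAverage_mul_volume (volume_ne_zero_of_mem_level hQ')
          (volume_ne_top_of_mem_level hQ'), ← hsU, volume_level_succ hQ' hc] at h1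
        have h2 : s * volume c ≤ (2 ^ (n + 1) * r) * volume c :=
          h1.trans (by
            calc _ ≤ 2 * r * (2 ^ n * volume c) := by gcongr
              _ = _ := by ring)
        exact (ENNReal.mul_le_mul_iff_left hv0 hvt).1 h2
      have h1 := ih c hc s (by rw [← hs]; exact le_mul_of_one_le_left' one_le_two)
      -- On the child the maximal function is at least `s`, so the truncated subtraction loses
      -- nothing and `V = Z - U`.
      set V := ∫⁻ x in c, (maximalFn (c.indicator w) x - s) with hV
      have hVZ : V + U = Z := by
        rw [← hsU, ← setLIntegral_const, hV, ← lintegral_add_right _ measurable_const, hZ]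
        refine setLIntegral_congr_fun hmeas fun x hx => ?_
        exact tsub_add_cancel_of_le (setLAverage_le_maximalFn hc hx)
      have h2 := stopping_arithmetic hβA (hfin hc) hVZ (hM c hc.1)
      -- Going back from threshold `s` to `r`: because `2r < s`, the removed mass `2r|c|` is at most
      -- `U`. This is the extra `1` in the coefficient `2A + 1`.
      have hZr : 2 * Z ≤ U + 2 * ∫⁻ x in c, (maximalFn (c.indicator w) x - r) := by
        have h3 : Z ≤ (∫⁻ x in c, (maximalFn (c.indicator w) x - r)) + r * volume c := by
          rw [← setLIntegral_const, ← lintegral_add_right _ measurable_const]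
          exact lintegral_mono fun x => le_tsub_add
        calc 2 * Z ≤ 2 * ((∫⁻ x in c, (maximalFn (c.indicator w) x - r)) + r * volume c) := by
              gcongr
          _ = 2 * r * volume c + 2 * ∫⁻ x in c, (maximalFn (c.indicator w) x - r) := by ring
          _ ≤ _ := by
              gcongr
              rw [← hsU]
              gcongr
      calc _ ≤ (2 ^ (n + 1) * s) ^ ε * ((2 * A + 1) * U + 2 * V) := h1
        _ = s ^ ε * ((2 ^ (n + 1)) ^ ε * ((2 * A + 1) * U + 2 * V)) := by
            rw [ENNReal.mul_rpow_of_nonneg _ _ hε]; ring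
        _ ≤ (2 ^ (n + 1) * r) ^ ε * (β * ((2 * A + 1) * U + 2 * V)) := by
            gcongr
        _ ≤ (2 ^ (n + 1) * r) ^ ε * (2 * A * U + 2 * Z) := by gcongr
        _ ≤ (2 ^ (n + 1) * r) ^ ε * (2 * A * U +
              (U + 2 * ∫⁻ x in c, (maximalFn (c.indicator w) x - r))) := by gcongr
        _ = _ := by ring
    rw [hD.lintegral_level_succ hQ', hD.lintegral_level_succ hQ' (fun x => ENNReal.ofReal (w x)),
      hD.lintegral_level_succ hQ' (fun x => maximalFn (Q.indicator w) x - r),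
      ← ENNReal.tsum_mul_left, ← ENNReal.tsum_mul_left, ← ENNReal.tsum_mul_left,
      ← ENNReal.tsum_add, ← ENNReal.tsum_mul_left]
    refine ENNReal.tsum_le_tsum fun c => (hchild c c.2.1 c.2.2).trans ?_
    gcongr with x
    exact maximalFn_indicator_mono c.2.2 x

/-- Start the truncated estimate at the threshold `r = ⟨w⟩_Q`; the Fujii-Wilson bound then turns the
right side into a multiple of `2A`, which cancels. -/
theorem lintegral_gridAvg_rpow_le (hD : IsDyadicGrid D) {w : (Fin n → ℝ) → ℝ}
    (hw : LocallyIntegrable w volume) {A β : ℝ≥0} (hA : 0 < A) {ε : ℝ} (hε : 0 ≤ ε)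
    (hβ : ((2 : ℝ≥0∞) ^ (n + 1)) ^ ε ≤ β) (hβA : 4 * A * β ≤ 4 * A + 1)
    (hM : ∀ Q ∈ D, ∫⁻ x in Q, maximalFn (Q.indicator w) x ≤ A * ∫⁻ x in Q, ENNReal.ofReal (w x))
    (k : ℤ) (N : ℕ) {Q : Set (Fin n → ℝ)} (hQ : Q ∈ level D (k + N)) :
      ∫⁻ x in Q, gridAvg hD k (fun y => ENNReal.ofReal (w y)) x ^ (1 + ε) ≤
        2 * (⨍⁻ x in Q, ENNReal.ofReal (w x) ∂volume) ^ ε * ∫⁻ x in Q, ENNReal.ofReal (w x) := by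
  have hfin : ∫⁻ x in Q, ENNReal.ofReal (w x) ≠ ∞ := by
    obtain ⟨-, a, rfl⟩ := hQ
    exact (lintegral_cube_ofReal_lt_top hw a (two_zpow_pos _).le).ne
  set s := ⨍⁻ x in Q, ENNReal.ofReal (w x) ∂volume with hs
  set U := ∫⁻ x in Q, ENNReal.ofReal (w x) with hU
  set Z := ∫⁻ x in Q, maximalFn (Q.indicator w) x with hZ
  have h1 := lintegral_gridAvg_rpow_le_truncated hD hw hε hβ hβA hM k N Q hQ s
    (by rw [← hs]; exact le_mul_of_one_le_left' one_le_two)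
  set V := ∫⁻ x in Q, (maximalFn (Q.indicator w) x - s) with hV
  have hVZ : V + U = Z := by
    rw [hU, ← setLAverage_mul_volume (volume_ne_zero_of_mem_level hQ)
      (volume_ne_top_of_mem_level hQ), ← hs, ← setLIntegral_const, hV,
      ← lintegral_add_right _ measurable_const, hZ]
    refine setLIntegral_congr_fun (measurableSet_of_mem_level hQ) fun x hx => ?_
    exact tsub_add_cancel_of_le (setLAverage_le_maximalFn hQ hx)
  have hZA : Z ≤ A * U := hM Q hQ.1
  have h2 := stopping_arithmetic hβA hfin hVZ hZA
  have hA0 : (2 * A : ℝ≥0∞) ≠ 0 := by simpa using hA.ne'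
  have hAt : (2 * A : ℝ≥0∞) ≠ ∞ := ENNReal.mul_ne_top (by simp) ENNReal.coe_ne_top
  refine (ENNReal.mul_le_mul_iff_right hA0 hAt).1 ?_
  calc _ ≤ (2 ^ (n + 1) * s) ^ ε * ((2 * A + 1) * U + 2 * V) := h1
    _ = s ^ ε * ((2 ^ (n + 1)) ^ ε * ((2 * A + 1) * U + 2 * V)) := by
        rw [ENNReal.mul_rpow_of_nonneg _ _ hε]; ring
    _ ≤ s ^ ε * (β * ((2 * A + 1) * U + 2 * V)) := by gcongr
    _ ≤ s ^ ε * (2 * A * U + 2 * Z) := by gcongr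
    _ ≤ s ^ ε * (2 * A * U + 2 * (A * U)) := by gcongr
    _ = _ := by ring

theorem ae_tendsto_gridAvg (hD : IsDyadicGrid D) {w : (Fin n → ℝ) → ℝ} (hw : IsWeight w) (K : ℤ) :
    ∀ᵐ x, Tendsto (fun j : ℕ => gridAvg hD (K - j) (fun y => ENNReal.ofReal (w y)) x) atTop
      (𝓝 (ENNReal.ofReal (w x))) := by
  filter_upwards [IsUnifLocDoublingMeasure.ae_tendsto_average (μ := volume) hw.1 1] with x hx
  have hlev : ∀ j : ℕ, ∃ a : Fin n → ℝ,
      gridCube hD (K - j) x = cube a ((2 : ℝ) ^ (K - (j : ℤ))) := fun j =>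
    (hD.gridCube_mem_level (K - j) x).2
  choose a ha using hlev
  have hδ : Tendsto (fun j : ℕ => (2 : ℝ) ^ (K - (j : ℤ)) / 2) atTop (𝓝[>] 0) := by
    refine tendsto_nhdsWithin_iff.2 ⟨?_, Eventually.of_forall fun j => by
      simp only [mem_Ioi]; positivity⟩
    have h1 : (fun j : ℕ => (2 : ℝ) ^ (K - (j : ℤ)) / 2)
        = fun j : ℕ => (2 : ℝ) ^ K / 2 * (1 / 2) ^ j := by
      funext j
      rw [zpow_sub₀ two_ne_zero, zpow_natCast]
      field_simp
      simp
    rw [h1]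
    simpa using (tendsto_pow_atTop_nhds_zero_of_lt_one (r := (1 / 2 : ℝ)) (by norm_num)
      (by norm_num)).const_mul ((2 : ℝ) ^ K / 2)
  have h2 := hx (fun (j : ℕ) i => a j i + (2 : ℝ) ^ (K - (j : ℤ)) / 2)
    (fun j : ℕ => (2 : ℝ) ^ (K - (j : ℤ)) / 2) hδ (Eventually.of_forall fun j => by
      rw [one_mul]
      refine cube_subset_closedBall_center (a j) (two_zpow_pos _).le ?_
      rw [← ha j]
      exact hD.mem_gridCube _ x)
  refine (ENNReal.tendsto_ofReal h2).congr fun j => ?_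
  rw [← setAverage_congr (cube_ae_eq_closedBall (a j) (two_zpow_pos (K - (j : ℤ))).le),
    ofReal_setAverage, gridAvg, ha j, setLAverage_eq]
  · exact (hw.1.integrableOn_isCompact (isCompact_closedBall (a j) _)).mono_set
      (cube_subset_closedBall (a j) (two_zpow_pos _).le)
  · exact ae_restrict_of_ae (hw.2.mono fun y hy => hy.le)

/-- The sharp **reverse Hölder inequality** for weights whose local maximal functions satisfy a
Fujii-Wilson bound on the cubes of a dyadic grid. -/
theorem lintegral_rpow_le_of_fujiiWilson (hD : IsDyadicGrid D) {w : (Fin n → ℝ) → ℝ}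
    (hw : IsWeight w) {A β : ℝ≥0} (hA : 0 < A) {ε : ℝ} (hε : 0 ≤ ε)
    (hβ : ((2 : ℝ≥0∞) ^ (n + 1)) ^ ε ≤ β) (hβA : 4 * A * β ≤ 4 * A + 1)
    (hM : ∀ Q ∈ D, ∫⁻ x in Q, maximalFn (Q.indicator w) x ≤ A * ∫⁻ x in Q, ENNReal.ofReal (w x))
    {Q : Set (Fin n → ℝ)} (hQ : Q ∈ D) :
    ∫⁻ x in Q, ENNReal.ofReal (w x) ^ (1 + ε) ≤
      2 * (⨍⁻ x in Q, ENNReal.ofReal (w x) ∂volume) ^ ε * ∫⁻ x in Q, ENNReal.ofReal (w x) := by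
  obtain ⟨K, hK⟩ := hD.exists_mem_level hQ
  -- The bound on averages is uniform in the scale, so Lebesgue differentiation and Fatou transfer
  -- it to `w` without prior knowledge that `w ^ (1 + ε)` is integrable.
  have hlim : ∀ᵐ x ∂(volume.restrict Q), ENNReal.ofReal (w x) ^ (1 + ε) = liminf (fun j : ℕ =>
      gridAvg hD (K - j) (fun y => ENNReal.ofReal (w y)) x ^ (1 + ε)) atTop := by
    filter_upwards [ae_restrict_of_ae (ae_tendsto_gridAvg hD hw K)] with x hx
    exact ((ENNReal.continuous_rpow_const.tendsto _).comp hx).liminf_eq.symm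
  rw [lintegral_congr_ae hlim]
  refine (lintegral_liminf_le fun j => (measurable_gridAvg hD _ _).pow_const _).trans ?_
  refine liminf_le_of_frequently_le' (Frequently.of_forall fun j => ?_)
  refine lintegral_gridAvg_rpow_le hD hw.1 hA hε hβ hβA hM (K - j) j ?_
  rwa [sub_add_cancel]

/-! ### The Muckenhoupt condition -/

theorem IsWeight.aemeasurable_ofReal {w : (Fin n → ℝ) → ℝ} (hw : IsWeight w) :
    AEMeasurable (fun x => ENNReal.ofReal (w x)) volume :=
  hw.1.aestronglyMeasurable.aemeasurable.ennreal_ofReal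

/-- For `p > 1`, apply Hölder to `F = (F w^{1/p}) · w^{-1/p}`; for `p = 1`, bound `w⁻¹` by its
essential supremum. This is the only way in which the `A_p` characteristic enters the estimates. -/
theorem setLAverage_mul_rpow_le_apConst {p : ℝ} (hp : 1 ≤ p) {w : (Fin n → ℝ) → ℝ}
    (hw : IsWeight w) {F : (Fin n → ℝ) → ℝ≥0∞} (hF : AEMeasurable F volume)
    (a : Fin n → ℝ) {l : ℝ} (hl : 0 < l) :
    (⨍⁻ x in cube a l, ENNReal.ofReal (w x) ∂volume) * (⨍⁻ x in cube a l, F x ∂volume) ^ p ≤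
      apConst p w * ⨍⁻ x in cube a l, F x ^ p * ENNReal.ofReal (w x) ∂volume := by
  have hpos : ∀ᵐ x ∂(volume.restrict (cube a l)), ENNReal.ofReal (w x) ≠ 0 :=
    ae_restrict_of_ae (hw.2.mono fun x hx => by simpa using hx)
  rcases hp.eq_or_lt with rfl | hp1
  · have h1 : ⨍⁻ x in cube a l, F x ∂volume ≤
        essSup (fun x => (ENNReal.ofReal (w x))⁻¹) (volume.restrict (cube a l)) *
          ⨍⁻ x in cube a l, F x * ENNReal.ofReal (w x) ∂volume := by
      rw [setLAverage_eq, setLAverage_eq, ← mul_div_assoc]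
      refine ENNReal.div_le_div_right ?_ _
      have hFw : AEMeasurable (fun x => F x * ENNReal.ofReal (w x)) (volume.restrict (cube a l)) :=
        hF.restrict.mul hw.aemeasurable_ofReal.restrict
      rw [← lintegral_const_mul'' _ hFw]
      refine lintegral_mono_ae ?_
      filter_upwards [hpos, ENNReal.ae_le_essSup (μ := volume.restrict (cube a l))
        (fun x => (ENNReal.ofReal (w x))⁻¹)] with x hx0 hx
      calc F x = (ENNReal.ofReal (w x))⁻¹ * (F x * ENNReal.ofReal (w x)) := by
            rw [mul_comm (F x), ← mul_assoc, ENNReal.inv_mul_cancel hx0 ENNReal.ofReal_ne_top,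
              one_mul]
        _ ≤ _ := by gcongr
    have h2 : essSup (fun x => (ENNReal.ofReal (w x))⁻¹) (volume.restrict (cube a l)) *
        ⨍⁻ x in cube a l, ENNReal.ofReal (w x) ∂volume ≤ apConst 1 w := by
      rw [apConst, if_pos rfl]
      exact le_iSup_of_le a <| le_iSup_of_le l <| le_iSup_of_le hl le_rfl
    simp only [ENNReal.rpow_one]
    calc _ ≤ (⨍⁻ x in cube a l, ENNReal.ofReal (w x) ∂volume) *
          (essSup (fun x => (ENNReal.ofReal (w x))⁻¹) (volume.restrict (cube a l)) *
          ⨍⁻ x in cube a l, F x * ENNReal.ofReal (w x) ∂volume) := by gcongr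
      _ = (essSup (fun x => (ENNReal.ofReal (w x))⁻¹) (volume.restrict (cube a l)) *
          (⨍⁻ x in cube a l, ENNReal.ofReal (w x) ∂volume)) *
          ⨍⁻ x in cube a l, F x * ENNReal.ofReal (w x) ∂volume := by ring
      _ ≤ _ := by gcongr
  · have hp0 : 0 < p := by linarith
    have hpq := Real.HolderConjugate.conjExponent hp1
    set q := p.conjExponent with hq
    have hq0 : 0 < q := hpq.symm.pos
    have hqp : -(1 / p) * q = 1 - q := by
      have h1 := hpq.mul_eq_add
      field_simp
      linarith
    have hqp' : 1 / q * p = p - 1 := by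
      have h1 := hpq.mul_eq_add
      field_simp
      linarith
    have h2 : (⨍⁻ x in cube a l, ENNReal.ofReal (w x) ∂volume) *
        (⨍⁻ x in cube a l, ENNReal.ofReal (w x) ^ (1 - q) ∂volume) ^ (p - 1) ≤ apConst p w := by
      rw [apConst, if_neg hp1.ne']
      exact le_iSup_of_le a <| le_iSup_of_le l <| le_iSup_of_le hl le_rfl
    have h1 : (⨍⁻ x in cube a l, F x ∂volume) ^ p ≤
        (⨍⁻ x in cube a l, F x ^ p * ENNReal.ofReal (w x) ∂volume) *
        (⨍⁻ x in cube a l, ENNReal.ofReal (w x) ^ (1 - q) ∂volume) ^ (p - 1) := by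
      rw [setLAverage_eq', setLAverage_eq', setLAverage_eq']
      set ν := (volume (cube a l))⁻¹ • volume.restrict (cube a l) with hν
      have hu : AEMeasurable (fun x => ENNReal.ofReal (w x)) ν :=
        hw.aemeasurable_ofReal.restrict.smul_measure _
      have hF' : AEMeasurable F ν := hF.restrict.smul_measure _
      have hpos' : ∀ᵐ x ∂ν, ENNReal.ofReal (w x) ≠ 0 := Measure.ae_smul_measure hpos _
      have h3 : ∫⁻ x, F x ∂ν = ∫⁻ x, ((fun x => F x * ENNReal.ofReal (w x) ^ (1 / p)) *
          fun x => ENNReal.ofReal (w x) ^ (-(1 / p))) x ∂ν := by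
        refine lintegral_congr_ae (hpos'.mono fun x hx => ?_)
        simp only [Pi.mul_apply]
        rw [mul_assoc, ← ENNReal.rpow_add _ _ hx ENNReal.ofReal_ne_top, add_neg_cancel,
          ENNReal.rpow_zero, mul_one]
      have h4 := ENNReal.lintegral_mul_le_Lp_mul_Lq ν hpq (hF'.mul (hu.pow_const (1 / p)))
        (hu.pow_const (-(1 / p)))
      have h5 : ∀ x, (F x * ENNReal.ofReal (w x) ^ (1 / p)) ^ p
          = F x ^ p * ENNReal.ofReal (w x) := fun x => by
        rw [ENNReal.mul_rpow_of_nonneg _ _ hp0.le, ← ENNReal.rpow_mul,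
          one_div_mul_cancel hp0.ne', ENNReal.rpow_one]
      have h6 : ∀ x, (ENNReal.ofReal (w x) ^ (-(1 / p))) ^ q
          = ENNReal.ofReal (w x) ^ (1 - q) := fun x => by
        rw [← ENNReal.rpow_mul, hqp]
      simp only [Pi.mul_apply, h5, h6] at h4
      rw [h3]
      simp only [Pi.mul_apply]
      calc _ ≤ _ := ENNReal.rpow_le_rpow h4 hp0.le
        _ = _ := by
          rw [ENNReal.mul_rpow_of_nonneg _ _ hp0.le, ← ENNReal.rpow_mul, ← ENNReal.rpow_mul,
            one_div_mul_cancel hp0.ne', ENNReal.rpow_one, hqp']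
    calc _ ≤ (⨍⁻ x in cube a l, ENNReal.ofReal (w x) ∂volume) *
          ((⨍⁻ x in cube a l, F x ^ p * ENNReal.ofReal (w x) ∂volume) *
          (⨍⁻ x in cube a l, ENNReal.ofReal (w x) ^ (1 - q) ∂volume) ^ (p - 1)) := by gcongr
      _ = ((⨍⁻ x in cube a l, ENNReal.ofReal (w x) ∂volume) *
          (⨍⁻ x in cube a l, ENNReal.ofReal (w x) ^ (1 - q) ∂volume) ^ (p - 1)) *
          (⨍⁻ x in cube a l, F x ^ p * ENNReal.ofReal (w x) ∂volume) := by ring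
      _ ≤ _ := by gcongr

/-! ### Finite sparse families -/

open Classical in
/-- The maximal members of a finite family of sets. -/
def maxPart (F : Finset (Set (Fin n → ℝ))) : Finset (Set (Fin n → ℝ)) :=
  F.filter fun Q => ∀ P ∈ F, Q ⊆ P → P ⊆ Q

theorem maxPart_subset (F : Finset (Set (Fin n → ℝ))) : maxPart F ⊆ F := by
  classical
  exact Finset.filter_subset _ _

theorem exists_mem_maxPart_superset {F : Finset (Set (Fin n → ℝ))} {Q : Set (Fin n → ℝ)}
    (hQ : Q ∈ F) : ∃ P ∈ maxPart F, Q ⊆ P := by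
  obtain ⟨P, hQP, hP⟩ := F.exists_le_maximal hQ
  exact ⟨P, by simpa [maxPart] using ⟨hP.1, fun R hR h => hP.2 hR h⟩, hQP⟩

theorem biUnion_maxPart (F : Finset (Set (Fin n → ℝ))) :
    ⋃ Q ∈ maxPart F, Q = ⋃ Q ∈ F, Q := by
  refine Subset.antisymm (biUnion_mono (maxPart_subset F) fun _ _ => Subset.rfl) ?_
  refine iUnion₂_subset fun Q hQ => ?_
  obtain ⟨P, hP, hQP⟩ := exists_mem_maxPart_superset hQ
  exact hQP.trans (subset_biUnion_of_mem (u := fun P => P) hP)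

theorem maxPart_pairwiseDisjoint (hD : IsDyadicGrid D) {F : Finset (Set (Fin n → ℝ))}
    (hF : ↑F ⊆ D) : (maxPart F : Set (Set (Fin n → ℝ))).PairwiseDisjoint id := by
  intro P hP Q hQ hPQ
  have hP' : P ∈ F ∧ ∀ R ∈ F, P ⊆ R → R ⊆ P := by simpa [maxPart] using hP
  have hQ' : Q ∈ F ∧ ∀ R ∈ F, Q ⊆ R → R ⊆ Q := by simpa [maxPart] using hQ
  rcases hD.disjoint_or_subset (hF hP'.1) (hF hQ'.1) with h | h | h
  · exact h
  · exact absurd (Subset.antisymm h (hP'.2 _ hQ'.1 h)) hPQ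
  · exact absurd (Subset.antisymm (hQ'.2 _ hP'.1 h) h) hPQ

/-- The **weak type (1, 1) estimate** for finitely many dyadic cubes. -/
theorem mul_volume_biUnion_le (hD : IsDyadicGrid D) {F : Finset (Set (Fin n → ℝ))}
    (hF : ↑F ⊆ D) {H : (Fin n → ℝ) → ℝ≥0∞} {y : ℝ≥0∞}
    (hy : ∀ Q ∈ F, y * volume Q ≤ ∫⁻ x in Q, H x) :
    y * volume (⋃ Q ∈ F, Q) ≤ ∫⁻ x, H x := by
  rw [← biUnion_maxPart]
  calc y * volume (⋃ Q ∈ maxPart F, Q) ≤ y * ∑ Q ∈ maxPart F, volume Q := by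
        gcongr
        exact measure_biUnion_finset_le _ _
    _ = ∑ Q ∈ maxPart F, y * volume Q := Finset.mul_sum _ _ _
    _ ≤ ∑ Q ∈ maxPart F, ∫⁻ x in Q, H x :=
        Finset.sum_le_sum fun Q hQ => hy Q (maxPart_subset F hQ)
    _ = ∫⁻ x in ⋃ Q ∈ maxPart F, Q, H x :=
        (lintegral_biUnion_finset (maxPart_pairwiseDisjoint hD hF)
          (fun Q hQ => hD.measurableSet (hF (maxPart_subset F hQ))) H).symm
    _ ≤ ∫⁻ x, H x := setLIntegral_le_lintegral _ _

section Sparse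

variable {S : Set (Set (Fin n → ℝ))} {E : Set (Fin n → ℝ) → Set (Fin n → ℝ)}

theorem sum_volume_le (hE : ∀ Q ∈ S, MeasurableSet (E Q) ∧ E Q ⊆ Q ∧ volume Q ≤ 2 * volume (E Q))
    (hd : S.PairwiseDisjoint E) {F : Finset (Set (Fin n → ℝ))} (hF : ↑F ⊆ S) :
    ∑ Q ∈ F, volume Q ≤ 2 * volume (⋃ Q ∈ F, Q) :=
  calc ∑ Q ∈ F, volume Q ≤ ∑ Q ∈ F, 2 * volume (E Q) :=
        Finset.sum_le_sum fun Q hQ => (hE Q (hF hQ)).2.2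
    _ = 2 * ∑ Q ∈ F, volume (E Q) := (Finset.mul_sum _ _ _).symm
    _ = 2 * volume (⋃ Q ∈ F, E Q) := by
        rw [measure_biUnion_finset (hd.subset hF) fun Q hQ => (hE Q (hF hQ)).1]
    _ ≤ 2 * volume (⋃ Q ∈ F, Q) := by
        gcongr with Q hQ
        exact (hE Q (hF hQ)).2.1

open Classical in
-- Sparseness bounds the total volume by twice that of the union, which the maximal cubes already
-- cover. Hence the maximal cubes carry at least half of the total volume.
theorem two_mul_sum_volume_sdiff_maxPart_le (hD : IsDyadicGrid D) (hS : S ⊆ D)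
    (hE : ∀ Q ∈ S, MeasurableSet (E Q) ∧ E Q ⊆ Q ∧ volume Q ≤ 2 * volume (E Q))
    (hd : S.PairwiseDisjoint E) {F : Finset (Set (Fin n → ℝ))} (hF : ↑F ⊆ S) :
    2 * ∑ Q ∈ F \ maxPart F, volume Q ≤ ∑ Q ∈ F, volume Q := by
  have h1 : ∑ Q ∈ F, volume Q ≤ 2 * ∑ Q ∈ maxPart F, volume Q := by
    refine (sum_volume_le hE hd hF).trans ?_
    rw [← biUnion_maxPart]
    gcongr
    exact measure_biUnion_finset_le _ _
  have ht : ∑ Q ∈ maxPart F, volume Q ≠ ∞ :=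
    (ENNReal.sum_lt_top.2 fun Q hQ =>
      (hD.volume_ne_top (hS (hF (maxPart_subset F hQ)))).lt_top).ne
  rw [← Finset.sum_sdiff (maxPart_subset F), two_mul] at h1 ⊢
  exact add_le_add_right ((ENNReal.add_le_add_iff_right ht).1 h1) _

/-! ### `L^q` norms of sums over sparse families -/

theorem lintegral_Lp_sum_le {ι : Type*} (s : Finset ι) {q : ℝ} (hq : 1 ≤ q)
    {φ : ι → (Fin n → ℝ) → ℝ≥0∞} (hφ : ∀ i ∈ s, AEMeasurable (φ i) volume) :
    (∫⁻ x, (∑ i ∈ s, φ i x) ^ q) ^ (1 / q) ≤ ∑ i ∈ s, (∫⁻ x, φ i x ^ q) ^ (1 / q) := by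
  classical
  have hq0 : 0 < q := by linarith
  induction s using Finset.induction_on with
  | empty => simp [hq0]
  | insert i s hi ih =>
    rw [Finset.sum_insert hi]
    simp only [Finset.sum_insert hi]
    have hs : ∀ j ∈ s, AEMeasurable (φ j) volume := fun j hj =>
      hφ j (Finset.mem_insert_of_mem hj)
    refine (ENNReal.lintegral_Lp_add_le (f := φ i) (g := fun x => ∑ j ∈ s, φ j x)
      (hφ i (Finset.mem_insert_self i s)) (Finset.aemeasurable_fun_sum s hs) hq).trans ?_
    gcongr
    exact ih hs

theorem sum_rpow_of_disjoint {F : Finset (Set (Fin n → ℝ))} {q : ℝ} (hq : 0 < q)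
    (hF : (F : Set (Set (Fin n → ℝ))).PairwiseDisjoint id)
    {φ : Set (Fin n → ℝ) → (Fin n → ℝ) → ℝ≥0∞} (h0 : ∀ Q ∈ F, ∀ x ∉ Q, φ Q x = 0)
    (x : Fin n → ℝ) : (∑ Q ∈ F, φ Q x) ^ q = ∑ Q ∈ F, φ Q x ^ q := by
  by_cases hx : ∃ P ∈ F, x ∈ P
  · obtain ⟨P, hP, hxP⟩ := hx
    have h : ∀ Q ∈ F, Q ≠ P → φ Q x = 0 := fun Q hQ hQP =>
      h0 Q hQ x fun hxQ => Set.disjoint_left.1 (hF hQ hP hQP) hxQ hxP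
    rw [Finset.sum_eq_single_of_mem P hP h, Finset.sum_eq_single_of_mem P hP]
    intro Q hQ hQP
    rw [h Q hQ hQP, ENNReal.zero_rpow_of_pos hq]
  · push Not at hx
    rw [Finset.sum_eq_zero fun Q hQ => h0 Q hQ x (hx Q hQ), ENNReal.zero_rpow_of_pos hq,
      Finset.sum_eq_zero]
    intro Q hQ
    rw [h0 Q hQ x (hx Q hQ), ENNReal.zero_rpow_of_pos hq]

/-- An `L^q` bound for sums, over a finite sparse family, of functions living on the cubes. -/
theorem lintegral_sum_rpow_le_of_sparse (hD : IsDyadicGrid D) (hS : S ⊆ D)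
    (hE : ∀ Q ∈ S, MeasurableSet (E Q) ∧ E Q ⊆ Q ∧ volume Q ≤ 2 * volume (E Q))
    (hd : S.PairwiseDisjoint E) {q : ℝ} (hq : 1 ≤ q) {K c : ℝ≥0∞}
    (hK : 1 + K * (1 / 2) ^ (1 / q) ≤ K) {φ : Set (Fin n → ℝ) → (Fin n → ℝ) → ℝ≥0∞}
    (F : Finset (Set (Fin n → ℝ))) : ↑F ⊆ S → (∀ Q ∈ F, AEMeasurable (φ Q) volume) →
    (∀ Q ∈ F, ∀ x ∉ Q, φ Q x = 0) → (∀ Q ∈ F, ∫⁻ x, φ Q x ^ q ≤ c * volume Q) →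
    (∫⁻ x, (∑ Q ∈ F, φ Q x) ^ q) ^ (1 / q) ≤ K * (c * ∑ Q ∈ F, volume Q) ^ (1 / q) := by
  classical
  have hq0 : 0 < q := by linarith
  induction F using Finset.strongInduction with
  | H F ih =>
  intro hF hφ h0 hc
  rcases F.eq_empty_or_nonempty with rfl | hne
  · simp [hq0]
  have hsub : F \ maxPart F ⊂ F := by
    refine Finset.sdiff_ssubset (maxPart_subset F) ?_
    obtain ⟨Q, hQ⟩ := hne
    obtain ⟨P, hP, -⟩ := exists_mem_maxPart_superset hQ
    exact ⟨P, hP⟩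
  -- Peel off the maximal cubes. They are disjoint, so their part is summed exactly; the rest has at
  -- most half the total volume, so its bound shrinks by `(1/2)^{1/q}`. The condition on `K` is what
  -- closes this recursion.
  have h1 := ih _ hsub ((Finset.coe_subset.2 hsub.1).trans hF) (fun Q hQ => hφ Q (hsub.1 hQ))
    (fun Q hQ => h0 Q (hsub.1 hQ)) (fun Q hQ => hc Q (hsub.1 hQ))
  have h2 : ∫⁻ x, (∑ Q ∈ maxPart F, φ Q x) ^ q ≤ c * ∑ Q ∈ F, volume Q := by
    have hm := maxPart_subset F
    calc ∫⁻ x, (∑ Q ∈ maxPart F, φ Q x) ^ q = ∫⁻ x, ∑ Q ∈ maxPart F, φ Q x ^ q := by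
          refine lintegral_congr fun x => ?_
          exact sum_rpow_of_disjoint hq0 (maxPart_pairwiseDisjoint hD (hF.trans hS))
            (fun Q hQ => h0 Q (hm hQ)) x
      _ = ∑ Q ∈ maxPart F, ∫⁻ x, φ Q x ^ q :=
          lintegral_finsetSum' _ fun Q hQ => (hφ Q (hm hQ)).pow_const q
      _ ≤ ∑ Q ∈ maxPart F, c * volume Q := Finset.sum_le_sum fun Q hQ => hc Q (hm hQ)
      _ = c * ∑ Q ∈ maxPart F, volume Q := (Finset.mul_sum _ _ _).symm
      _ ≤ c * ∑ Q ∈ F, volume Q := by gcongr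
  have h3 : c * ∑ Q ∈ F \ maxPart F, volume Q ≤ 1 / 2 * (c * ∑ Q ∈ F, volume Q) := by
    have h4 := two_mul_sum_volume_sdiff_maxPart_le hD hS hE hd hF
    calc c * ∑ Q ∈ F \ maxPart F, volume Q
        = (1 / 2 * 2) * (c * ∑ Q ∈ F \ maxPart F, volume Q) := by
          rw [ENNReal.div_mul_cancel two_ne_zero ENNReal.ofNat_ne_top, one_mul]
      _ = 1 / 2 * (c * (2 * ∑ Q ∈ F \ maxPart F, volume Q)) := by ring
      _ ≤ _ := by gcongr
  have hsum : ∀ x, ∑ Q ∈ F, φ Q x = ∑ Q ∈ F \ maxPart F, φ Q x + ∑ Q ∈ maxPart F, φ Q x :=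
    fun x => (Finset.sum_sdiff (maxPart_subset F)).symm
  simp only [hsum]
  calc _ ≤ (∫⁻ x, (∑ Q ∈ F \ maxPart F, φ Q x) ^ q) ^ (1 / q)
        + (∫⁻ x, (∑ Q ∈ maxPart F, φ Q x) ^ q) ^ (1 / q) :=
        ENNReal.lintegral_Lp_add_le
          (f := fun x => ∑ Q ∈ F \ maxPart F, φ Q x) (g := fun x => ∑ Q ∈ maxPart F, φ Q x)
          (Finset.aemeasurable_fun_sum _ fun Q hQ => hφ Q (hsub.1 hQ))
          (Finset.aemeasurable_fun_sum _ fun Q hQ => hφ Q (maxPart_subset F hQ)) hq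
    _ ≤ K * (1 / 2 * (c * ∑ Q ∈ F, volume Q)) ^ (1 / q)
        + (c * ∑ Q ∈ F, volume Q) ^ (1 / q) := by
        gcongr
        exact h1.trans (by gcongr)
    _ = (1 + K * (1 / 2) ^ (1 / q)) * (c * ∑ Q ∈ F, volume Q) ^ (1 / q) := by
        rw [ENNReal.mul_rpow_of_nonneg _ _ (by positivity : 0 ≤ 1 / q)]
        ring
    _ ≤ _ := by gcongr

/-! ### Layers of comparable averages and the level set estimate -/

variable {u H : (Fin n → ℝ) → ℝ≥0∞} {a : Set (Fin n → ℝ) → ℝ≥0∞} {p ε : ℝ}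

/-- Reverse Hölder gives each cube the constant `2 y^{1+ε}`. The total volume of the layer is
controlled by the weak type (1, 1) estimate and costs only one factor `y⁻¹`, so `y^ε` is left as
decay. -/
theorem lintegral_layer_le (hD : IsDyadicGrid D) (hS : S ⊆ D)
    (hE : ∀ Q ∈ S, MeasurableSet (E Q) ∧ E Q ⊆ Q ∧ volume Q ≤ 2 * volume (E Q))
    (hd : S.PairwiseDisjoint E) (hp : 1 ≤ p) (hε : 0 < ε) (hu : AEMeasurable u volume)
    (hRH : ∀ Q ∈ S, ∫⁻ x in Q, u x ^ (1 + ε) ≤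
      2 * (⨍⁻ x in Q, u x ∂volume) ^ ε * ∫⁻ x in Q, u x)
    {K : ℝ≥0∞} (hK : 1 + K * (1 / 2) ^ (1 / (p * (1 + ε))) ≤ K) {y : ℝ≥0∞}
    {F : Finset (Set (Fin n → ℝ))} (hF : ↑F ⊆ S)
    (hay : ∀ Q ∈ F, (⨍⁻ x in Q, u x ∂volume) * a Q ^ p ≤ y)
    (hyH : ∀ Q ∈ F, y * volume Q ≤ 2 * ∫⁻ x in Q, H x) :
    (∫⁻ x, (∑ Q ∈ F, Q.indicator (fun x => a Q * u x ^ (1 / p)) x) ^ (p * (1 + ε))) ^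
      (1 / (p * (1 + ε))) ≤ K * (8 * (y ^ ε * ∫⁻ x, H x)) ^ (1 / (p * (1 + ε))) := by
  have hp0 : 0 < p := by linarith
  set q := p * (1 + ε) with hq
  have hq1 : 1 ≤ q := by nlinarith
  have hq0 : 0 < q := by linarith
  have hmeas : ∀ Q ∈ F, MeasurableSet Q := fun Q hQ => hD.measurableSet (hS (hF hQ))
  have hpq : 1 / p * q = 1 + ε := by rw [hq]; field_simp
  refine (lintegral_sum_rpow_le_of_sparse hD hS hE hd hq1 hK (c := 2 * y ^ (1 + ε))
    (φ := fun Q => Q.indicator (fun x => a Q * u x ^ (1 / p))) F hF ?_ ?_ ?_).trans ?_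
  · exact fun Q hQ => ((hu.pow_const _).const_mul _).indicator (hmeas Q hQ)
  · exact fun Q _ x hx => indicator_of_notMem hx _
  · intro Q hQ
    have h0 := hD.volume_ne_zero (hS (hF hQ))
    have ht := hD.volume_ne_top (hS (hF hQ))
    set m := ⨍⁻ x in Q, u x ∂volume with hm
    have h1 : ∀ x, Q.indicator (fun x => a Q * u x ^ (1 / p)) x ^ q
        = Q.indicator (fun x => a Q ^ q * u x ^ (1 + ε)) x := by
      intro x
      by_cases hx : x ∈ Q
      · rw [indicator_of_mem hx, indicator_of_mem hx, ENNReal.mul_rpow_of_nonneg _ _ hq0.le,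
          ← ENNReal.rpow_mul, hpq]
      · rw [indicator_of_notMem hx, indicator_of_notMem hx, ENNReal.zero_rpow_of_pos hq0]
    calc ∫⁻ x, Q.indicator (fun x => a Q * u x ^ (1 / p)) x ^ q
        = ∫⁻ x in Q, a Q ^ q * u x ^ (1 + ε) := by
          simp only [h1]
          rw [lintegral_indicator (hmeas Q hQ)]
      _ = a Q ^ q * ∫⁻ x in Q, u x ^ (1 + ε) :=
          lintegral_const_mul'' _ (hu.restrict.pow_const _)
      _ ≤ a Q ^ q * (2 * m ^ ε * (m * volume Q)) := by
          rw [hm, setLAverage_mul_volume h0 ht]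
          gcongr
          exact hRH Q (hF hQ)
      -- The choice `q = p(1+ε)` makes the powers of `a Q` and of the average combine into one power
      -- of `m * a Q ^ p`.
      _ = 2 * (m * a Q ^ p) ^ (1 + ε) * volume Q := by
          rw [ENNReal.mul_rpow_of_nonneg _ _ (by positivity), ← ENNReal.rpow_mul, ← hq,
            ENNReal.rpow_add_of_nonneg _ _ zero_le_one hε.le, ENNReal.rpow_one]
          ring
      _ ≤ 2 * y ^ (1 + ε) * volume Q := by
          gcongr
          exact hay Q hQ
  · have h1 : y * volume (⋃ Q ∈ F, Q) ≤ 2 * ∫⁻ x, H x := by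
      have := mul_volume_biUnion_le hD (hF.trans hS) (H := fun x => 2 * H x) (y := y)
        (fun Q hQ => (hyH Q hQ).trans_eq (lintegral_const_mul' _ _ (by simp)).symm)
      rwa [lintegral_const_mul' _ _ (by simp)] at this
    gcongr K * ?_ ^ (1 / q)
    calc 2 * y ^ (1 + ε) * ∑ Q ∈ F, volume Q
        ≤ 2 * y ^ (1 + ε) * (2 * volume (⋃ Q ∈ F, Q)) := by
          gcongr
          exact sum_volume_le hE hd hF
      _ = 4 * y ^ ε * (y * volume (⋃ Q ∈ F, Q)) := by
          rw [ENNReal.rpow_add_of_nonneg _ _ zero_le_one hε.le, ENNReal.rpow_one]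
          ring
      _ ≤ 4 * y ^ ε * (2 * ∫⁻ x, H x) := by gcongr
      _ = _ := by ring

theorem exists_half_pow_near {y : ℝ≥0∞} (h0 : y ≠ 0) (h1 : y ≤ 1) :
    ∃ j : ℕ, y ≤ (1 / 2) ^ j ∧ (1 / 2) ^ j ≤ 2 * y := by
  lift y to ℝ≥0 using ne_top_of_le_ne_top ENNReal.one_ne_top h1
  obtain ⟨j, hj1, hj2⟩ := exists_nat_pow_near_of_lt_one (x := y) (y := 1 / 2)
    (pos_iff_ne_zero.2 (by simpa using h0)) (by simpa using h1) (by norm_num)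
    (by rw [div_lt_one two_pos]; exact one_lt_two)
  have hc : ((1 / 2 : ℝ≥0) : ℝ≥0∞) = 1 / 2 := by
    rw [ENNReal.coe_div two_ne_zero]
    simp
  refine ⟨j, ?_, ?_⟩
  · rw [← hc]
    exact_mod_cast hj2
  · rw [← hc]
    have : (1 / 2 : ℝ≥0) ^ j ≤ 2 * y := by
      calc (1 / 2 : ℝ≥0) ^ j = 2 * (1 / 2) ^ (j + 1) := by
            rw [pow_succ]; field_simp
        _ ≤ 2 * y := by gcongr
    exact_mod_cast this

/-- The union of the cubes with large `⟨H⟩_Q` is discarded as an exceptional set. Elsewhere the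
geometric decay of the layers permits the triangle inequality in `L^q`, and Chebyshev finishes. -/
theorem volume_lt_sum_le (hD : IsDyadicGrid D) (hS : S ⊆ D)
    (hE : ∀ Q ∈ S, MeasurableSet (E Q) ∧ E Q ⊆ Q ∧ volume Q ≤ 2 * volume (E Q))
    (hd : S.PairwiseDisjoint E) (hp : 1 ≤ p) (hε : 0 < ε) (hu : AEMeasurable u volume)
    (hRH : ∀ Q ∈ S, ∫⁻ x in Q, u x ^ (1 + ε) ≤
      2 * (⨍⁻ x in Q, u x ∂volume) ^ ε * ∫⁻ x in Q, u x)
    {K : ℝ≥0∞} (hK : 1 + K * (1 / 2) ^ (1 / (p * (1 + ε))) ≤ K)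
    (hu0 : ∀ Q ∈ S, ⨍⁻ x in Q, u x ∂volume ≠ 0)
    (haH : ∀ Q ∈ S, (⨍⁻ x in Q, u x ∂volume) * a Q ^ p ≤ ⨍⁻ x in Q, H x ∂volume)
    {F : Finset (Set (Fin n → ℝ))} (hF : ↑F ⊆ S) :
    volume {x | 1 < u x ^ (1 / p) * ∑ Q ∈ F, Q.indicator (fun _ => a Q) x} ≤
      (1 + 8 * (K * ∑' j : ℕ, ((1 / 2) ^ (ε / (p * (1 + ε)))) ^ j) ^ (p * (1 + ε))) *
        ∫⁻ x, H x := by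
  classical
  have hp0 : 0 < p := by linarith
  have hq1 : 1 ≤ p * (1 + ε) := by nlinarith
  have hq0 : 0 < p * (1 + ε) := by linarith
  set q := p * (1 + ε) with hq
  set avg : Set (Fin n → ℝ) → ℝ≥0∞ := fun Q => ⨍⁻ x in Q, H x ∂volume with havg
  have hvH : ∀ Q ∈ S, avg Q * volume Q = ∫⁻ x in Q, H x := fun Q hQ =>
    setLAverage_mul_volume (hD.volume_ne_zero (hS hQ)) (hD.volume_ne_top (hS hQ))
  set F₁ := F.filter fun Q => 1 < avg Q with hF₁
  set F₂ := F.filter fun Q => avg Q ≤ 1 ∧ avg Q ≠ 0 with hF₂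
  have hF₁S : ↑F₁ ⊆ S := (Finset.coe_subset.2 (Finset.filter_subset _ _)).trans hF
  have hF₂S : ↑F₂ ⊆ S := (Finset.coe_subset.2 (Finset.filter_subset _ _)).trans hF
  set φ : Set (Fin n → ℝ) → (Fin n → ℝ) → ℝ≥0∞ := fun Q =>
    Q.indicator (fun x => a Q * u x ^ (1 / p)) with hφ
  have hφm : ∀ Q ∈ S, AEMeasurable (φ Q) volume := fun Q hQ =>
    ((hu.pow_const _).const_mul _).indicator (hD.measurableSet (hS hQ))
  have hsub : {x | 1 < u x ^ (1 / p) * ∑ Q ∈ F, Q.indicator (fun _ => a Q) x} ⊆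
      (⋃ Q ∈ F₁, Q) ∪ {x | 1 ≤ (∑ Q ∈ F₂, φ Q x) ^ q} := by
    intro x hx
    by_cases hx1 : x ∈ ⋃ Q ∈ F₁, Q
    · exact Or.inl hx1
    right
    have h1 : u x ^ (1 / p) * ∑ Q ∈ F, Q.indicator (fun _ => a Q) x = ∑ Q ∈ F₂, φ Q x := by
      rw [Finset.mul_sum, hF₂, Finset.sum_filter]
      refine Finset.sum_congr rfl fun Q hQ => ?_
      by_cases hxQ : x ∈ Q
      · have hQ1 : avg Q ≤ 1 := by
          by_contra h
          exact hx1 (mem_biUnion (Finset.mem_coe.2 (Finset.mem_filter.2 ⟨hQ, not_le.1 h⟩)) hxQ)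
        -- Cubes with `⟨H⟩_Q = 0` belong to no dyadic layer, but they have `a Q = 0` because the
        -- average of `u` is nonzero.
        by_cases hQ0 : avg Q = 0
        · rw [if_neg (by simp [hQ0]), indicator_of_mem hxQ]
          have h2 := haH Q (hF hQ)
          rw [show ⨍⁻ x in Q, H x ∂volume = 0 from hQ0, nonpos_iff_eq_zero, mul_eq_zero,
            ENNReal.rpow_eq_zero_iff_of_pos hp0] at h2
          rw [h2.resolve_left (hu0 Q (hF hQ)), mul_zero]
        · rw [if_pos ⟨hQ1, hQ0⟩, hφ]
          simp only [indicator_of_mem hxQ]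
          exact mul_comm _ _
      · simp [hφ, hxQ]
    rw [mem_ofPred_eq, h1] at hx
    rw [mem_ofPred_eq]
    exact ENNReal.one_le_rpow hx.le hq0
  have hΩ : volume (⋃ Q ∈ F₁, Q) ≤ ∫⁻ x, H x := by
    rw [← one_mul (volume _)]
    refine mul_volume_biUnion_le hD (hF₁S.trans hS) fun Q hQ => ?_
    rw [← hvH Q (hF₁S hQ)]
    gcongr
    exact (Finset.mem_filter.1 hQ).2.le
  have hj : ∀ Q, ∃ j : ℕ, Q ∈ F₂ → avg Q ≤ (1 / 2) ^ j ∧ (1 / 2) ^ j ≤ 2 * avg Q := by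
    intro Q
    by_cases hQ : Q ∈ F₂
    · obtain ⟨j, hj⟩ := exists_half_pow_near (Finset.mem_filter.1 hQ).2.2
        (Finset.mem_filter.1 hQ).2.1
      exact ⟨j, fun _ => hj⟩
    · exact ⟨0, fun h => absurd h hQ⟩
  choose j hj using hj
  have hlayer : ∀ i : ℕ,
      (∫⁻ x, (∑ Q ∈ F₂ with j Q = i, φ Q x) ^ q) ^ (1 / q) ≤
        K * (8 * ∫⁻ x, H x) ^ (1 / q) * ((1 / 2) ^ (ε / q)) ^ i := by
    intro i
    have hsub' : ↑(F₂.filter fun Q => j Q = i) ⊆ S :=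
      (Finset.coe_subset.2 (Finset.filter_subset _ _)).trans hF₂S
    refine (lintegral_layer_le (a := a) (H := H) (y := (1 / 2) ^ i) hD hS hE hd hp hε hu hRH hK
      hsub' ?_ ?_).trans_eq ?_
    · intro Q hQ
      obtain ⟨hQ1, hQ2⟩ := Finset.mem_filter.1 hQ
      refine (haH Q (hF₂S hQ1)).trans ?_
      rw [← hQ2]
      exact (hj Q hQ1).1
    · intro Q hQ
      obtain ⟨hQ1, hQ2⟩ := Finset.mem_filter.1 hQ
      rw [← hvH Q (hF₂S hQ1), ← mul_assoc, ← hQ2]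
      gcongr
      exact (hj Q hQ1).2
    · have hq' : 0 ≤ 1 / q := by positivity
      rw [← hq, ← mul_assoc, mul_comm 8, mul_assoc, ENNReal.mul_rpow_of_nonneg _ _ hq',
        ← ENNReal.rpow_natCast, ← ENNReal.rpow_natCast, ← ENNReal.rpow_mul, ← ENNReal.rpow_mul,
        ← ENNReal.rpow_mul, mul_comm (_ ^ _ : ℝ≥0∞), ← mul_assoc]
      congr 2
      ring
  have hnorm : (∫⁻ x, (∑ Q ∈ F₂, φ Q x) ^ q) ^ (1 / q) ≤
      K * (8 * ∫⁻ x, H x) ^ (1 / q) * ∑' i : ℕ, ((1 / 2) ^ (ε / q)) ^ i := by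
    have h1 : ∀ x, ∑ Q ∈ F₂, φ Q x = ∑ i ∈ F₂.image j, ∑ Q ∈ F₂ with j Q = i, φ Q x :=
      fun x => (Finset.sum_fiberwise_of_maps_to
        (fun Q hQ => Finset.mem_image_of_mem j hQ) _).symm
    simp only [h1]
    refine (lintegral_Lp_sum_le (F₂.image j) hq1 (φ := fun i x => ∑ Q ∈ F₂ with j Q = i, φ Q x)
      fun i _ => Finset.aemeasurable_fun_sum _ fun Q hQ =>
        hφm Q (hF₂S (Finset.mem_filter.1 hQ).1)).trans ?_
    refine (Finset.sum_le_sum fun i _ => hlayer i).trans ?_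
    rw [← Finset.mul_sum]
    gcongr
    exact ENNReal.sum_le_tsum _
  have hcheb : volume {x | 1 ≤ (∑ Q ∈ F₂, φ Q x) ^ q} ≤ ∫⁻ x, (∑ Q ∈ F₂, φ Q x) ^ q := by
    have := mul_meas_ge_le_lintegral₀ (μ := volume)
      ((Finset.aemeasurable_fun_sum F₂ fun Q hQ => hφm Q (hF₂S hQ)).pow_const q) 1
    rwa [one_mul] at this
  have hfin : ∫⁻ x, (∑ Q ∈ F₂, φ Q x) ^ q ≤
      (K * ∑' i : ℕ, ((1 / 2) ^ (ε / q)) ^ i) ^ q * (8 * ∫⁻ x, H x) := by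
    have h1 := ENNReal.rpow_le_rpow hnorm hq0.le
    rw [← ENNReal.rpow_mul, one_div_mul_cancel hq0.ne', ENNReal.rpow_one] at h1
    refine h1.trans_eq ?_
    rw [mul_right_comm, ENNReal.mul_rpow_of_nonneg _ _ hq0.le, ← ENNReal.rpow_mul,
      one_div_mul_cancel hq0.ne', ENNReal.rpow_one]
  calc _ ≤ volume (⋃ Q ∈ F₁, Q) + volume {x | 1 ≤ (∑ Q ∈ F₂, φ Q x) ^ q} :=
        (measure_mono hsub).trans (measure_union_le _ _)
    _ ≤ (∫⁻ x, H x) + (K * ∑' i : ℕ, ((1 / 2) ^ (ε / q)) ^ i) ^ q * (8 * ∫⁻ x, H x) := by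
        gcongr
        exact hcheb.trans hfin
    _ = _ := by ring

end Sparse

/-! ### Numerical constants -/

/-- Bernoulli's inequality for exponents in `[0, 1]`, at base `1 - 1/2`. -/
theorem half_rpow_le {s : ℝ} (h0 : 0 ≤ s) (h1 : s ≤ 1) : (1 / 2 : ℝ) ^ s ≤ 1 - s / 2 := by
  have := rpow_one_add_le_one_add_mul_self (s := -1 / 2) (by norm_num) h0 h1
  norm_num at this ⊢
  linarith

theorem ennreal_half_rpow (s : ℝ) : (1 / 2 : ℝ≥0∞) ^ s = ENNReal.ofReal ((1 / 2 : ℝ) ^ s) := by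
  rw [← ENNReal.ofReal_rpow_of_pos (by norm_num), ENNReal.ofReal_div_of_pos two_pos]
  simp

theorem one_add_mul_half_rpow_le {q K : ℝ} (hq : 1 ≤ q) (hK : 2 * q ≤ K) :
    1 + ENNReal.ofReal K * (1 / 2) ^ (1 / q) ≤ ENNReal.ofReal K := by
  have hq0 : 0 < q := by linarith
  have hK0 : 0 ≤ K := by linarith
  have h := half_rpow_le (s := 1 / q) (by positivity) (by rw [div_le_one hq0]; exact hq)
  rw [ennreal_half_rpow, ← ENNReal.ofReal_mul hK0, ← ENNReal.ofReal_one,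
    ← ENNReal.ofReal_add zero_le_one (by positivity)]
  refine ENNReal.ofReal_le_ofReal ?_
  have h2 : 1 ≤ K * (1 / q / 2) := by
    rw [div_div, mul_one_div, le_div_iff₀ (by positivity)]
    linarith
  nlinarith [mul_le_mul_of_nonneg_left h hK0]

theorem tsum_half_rpow_le {s : ℝ} (h0 : 0 < s) (h1 : s ≤ 1) :
    ∑' j : ℕ, ((1 / 2 : ℝ≥0∞) ^ s) ^ j ≤ ENNReal.ofReal (2 / s) := by
  have h := half_rpow_le h0.le h1
  rw [ENNReal.tsum_geometric, ennreal_half_rpow, ← ENNReal.ofReal_one,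
    ← ENNReal.ofReal_sub _ (by positivity), ← ENNReal.ofReal_inv_of_pos (by linarith)]
  refine ENNReal.ofReal_le_ofReal ?_
  rw [show 2 / s = (s / 2)⁻¹ by rw [inv_div]]
  exact inv_anti₀ (by linarith) (by linarith)

/-- The surplus power is harmless because `X^{p/X} = exp(p log X / X) ≤ exp p`. This keeps the
exponent of `[w]_{A_∞}` at exactly `p`. -/
theorem rpow_add_inv_le {p X c : ℝ} (hp : 1 ≤ p) (hX : 1 ≤ X) (hc : 1 ≤ c) :
    (c * X) ^ (p * (1 + 1 / X)) ≤ c ^ (2 * p) * (X ^ p * Real.exp p) := by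
  have hp0 : 0 < p := by linarith
  have hX0 : 0 < X := by linarith
  have hX1 : 1 / X ≤ 1 := by rw [div_le_one hX0]; exact hX
  rw [Real.mul_rpow (by linarith) hX0.le]
  have h1 : c ^ (p * (1 + 1 / X)) ≤ c ^ (2 * p) :=
    Real.rpow_le_rpow_of_exponent_le hc (by nlinarith)
  have h2 : X ^ (p * (1 + 1 / X)) ≤ X ^ p * Real.exp p := by
    rw [mul_add, mul_one, Real.rpow_add hX0]
    gcongr
    rw [Real.rpow_def_of_pos hX0]
    refine Real.exp_le_exp.2 ?_
    have h3 := Real.log_le_sub_one_of_pos hX0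
    calc Real.log X * (p * (1 / X)) ≤ X * (p * (1 / X)) := by gcongr; linarith
      _ = p := by field_simp
  gcongr

/-- The constant of the weak type estimate for sparse operators. -/
def weakConst (n : ℕ) (p : ℝ) : ℝ≥0 :=
  Real.toNNReal (1 + 8 * ((16 * p ^ 2) ^ (2 * p) * ((4 * (n + 1 : ℝ)) ^ p * Real.exp p)))

theorem weakConst_ne_zero (n : ℕ) {p : ℝ} (hp : 1 ≤ p) : weakConst n p ≠ 0 := by
  have hp0 : 0 < p := by linarith
  refine (Real.toNNReal_pos.2 ?_).ne'
  positivity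

/-- Here `1/ε = X`, and `q ≤ 2p` bounds the geometric series by `2q/ε ≤ 4pX`. Together with `K = 4p`
this gives the base `16 p² X`. -/
theorem sparse_factor_le {p ε : ℝ} (hp : 1 ≤ p) {A : ℝ≥0} (hA : 1 ≤ A)
    (hε : ε = 1 / (4 * (n + 1 : ℝ) * A)) :
    1 + 8 * (ENNReal.ofReal (4 * p) *
      ∑' j : ℕ, ((1 / 2) ^ (ε / (p * (1 + ε)))) ^ j) ^ (p * (1 + ε)) ≤
      (weakConst n p : ℝ≥0∞) * (A : ℝ≥0∞) ^ p := by
  have hp0 : 0 < p := by linarith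
  have hA1 : (1 : ℝ) ≤ A := by exact_mod_cast hA
  have hn : (0 : ℝ) ≤ n := n.cast_nonneg
  set X : ℝ := 4 * (n + 1 : ℝ) * A with hX
  have hX1 : 1 ≤ X := by
    rw [hX]
    nlinarith [mul_le_mul_of_nonneg_left hA1 (by positivity : 0 ≤ 4 * (n + 1 : ℝ))]
  have hX0 : 0 < X := by linarith
  have hε0 : 0 < ε := by rw [hε]; positivity
  have hε1 : ε ≤ 1 := by rw [hε, div_le_one hX0]; exact hX1
  set q := p * (1 + ε) with hq
  have hq1 : 1 ≤ q := by nlinarith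
  have hq0 : 0 < q := by linarith
  have hq2 : q ≤ 2 * p := by nlinarith
  have h1 : ENNReal.ofReal (4 * p) * ∑' j : ℕ, ((1 / 2 : ℝ≥0∞) ^ (ε / q)) ^ j ≤
      ENNReal.ofReal (16 * p ^ 2 * X) := by
    calc _ ≤ ENNReal.ofReal (4 * p) * ENNReal.ofReal (2 / (ε / q)) := by
          gcongr
          refine tsum_half_rpow_le (by positivity) ?_
          rw [div_le_one hq0]
          linarith
      _ = ENNReal.ofReal (4 * p * (2 / (ε / q))) := (ENNReal.ofReal_mul (by positivity)).symm
      _ ≤ _ := by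
          refine ENNReal.ofReal_le_ofReal ?_
          have : 2 / (ε / q) = 2 * q * X := by
            rw [hε]; field_simp
          rw [this]
          calc 4 * p * (2 * q * X) ≤ 4 * p * (2 * (2 * p) * X) := by gcongr
            _ = 16 * p ^ 2 * X := by ring
  have h2 := rpow_add_inv_le (c := 16 * p ^ 2) hp hX1 (by nlinarith)
  rw [← hε, ← hq] at h2
  have h3 : X ^ p = (4 * (n + 1 : ℝ)) ^ p * (A : ℝ) ^ p :=
    Real.mul_rpow (by positivity) A.coe_nonneg
  have h4 : (1 : ℝ) ≤ (A : ℝ) ^ p := Real.one_le_rpow hA1 hp0.le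
  calc _ ≤ 1 + 8 * (ENNReal.ofReal (16 * p ^ 2 * X)) ^ q := by gcongr
    _ = ENNReal.ofReal (1 + 8 * (16 * p ^ 2 * X) ^ q) := by
        rw [ENNReal.ofReal_rpow_of_nonneg (by positivity) hq0.le,
          ENNReal.ofReal_add zero_le_one (by positivity), ENNReal.ofReal_mul (by norm_num)]
        simp
    _ ≤ ENNReal.ofReal ((1 + 8 * ((16 * p ^ 2) ^ (2 * p) *
          ((4 * (n + 1 : ℝ)) ^ p * Real.exp p))) * (A : ℝ) ^ p) := by
        refine ENNReal.ofReal_le_ofReal ?_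
        rw [h3] at h2
        nlinarith
    _ = _ := by
        rw [ENNReal.ofReal_mul (by positivity), ← ENNReal.ofReal_rpow_of_nonneg A.coe_nonneg hp0.le,
          ENNReal.ofReal_coe_nnreal]
        rfl

/-! ### The weak type estimate -/

theorem lintegral_cube_ofReal_ne_zero {w : (Fin n → ℝ) → ℝ} (hw : IsWeight w) (a : Fin n → ℝ)
    {l : ℝ} (hl : 0 < l) : ∫⁻ x in cube a l, ENNReal.ofReal (w x) ≠ 0 := by
  intro h
  rw [lintegral_eq_zero_iff' hw.aemeasurable_ofReal.restrict] at h
  have h1 : ∀ᵐ x ∂(volume.restrict (cube a l)), False := by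
    filter_upwards [h, ae_restrict_of_ae hw.2] with x hx1 hx2
    simp only [Pi.zero_apply, ENNReal.ofReal_eq_zero] at hx1
    linarith
  rw [ae_iff] at h1
  simp only [not_false_eq_true] at h1
  have h2 : volume.restrict (cube a l) univ = 0 := h1
  rw [Measure.restrict_apply_univ] at h2
  exact volume_cube_ne_zero a hl h2

theorem setLAverage_cube_ofReal_ne_zero {w : (Fin n → ℝ) → ℝ} (hw : IsWeight w) (a : Fin n → ℝ)
    {l : ℝ} (hl : 0 < l) : ⨍⁻ x in cube a l, ENNReal.ofReal (w x) ∂volume ≠ 0 := by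
  rw [setLAverage_eq]
  exact ENNReal.div_ne_zero.2 ⟨lintegral_cube_ofReal_ne_zero hw a hl, volume_cube_ne_top a l⟩

theorem lintegral_maximalFn_le_ainftyConst {w : (Fin n → ℝ) → ℝ} (hw : IsWeight w)
    (a : Fin n → ℝ) {l : ℝ} (hl : 0 < l) :
    ∫⁻ x in cube a l, maximalFn ((cube a l).indicator w) x ≤
      ainftyConst w * ∫⁻ x in cube a l, ENNReal.ofReal (w x) := by
  rw [← ENNReal.div_le_iff (lintegral_cube_ofReal_ne_zero hw a hl)
    (lintegral_cube_ofReal_lt_top hw.1 a hl.le).ne]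
  exact le_iSup_of_le a <| le_iSup_of_le l <| le_iSup_of_le hl le_rfl

theorem one_le_ainftyConst (hD : IsDyadicGrid D) {w : (Fin n → ℝ) → ℝ} (hw : IsWeight w) :
    1 ≤ ainftyConst w := by
  have hQ := hD.gridCube_mem_level 0 0
  obtain ⟨-, a, ha⟩ := id hQ
  have h0 := lintegral_cube_ofReal_ne_zero hw a (two_zpow_pos 0)
  have ht := (lintegral_cube_ofReal_lt_top hw.1 a (two_zpow_pos 0).le).ne
  have h1 := lintegral_maximalFn_le_ainftyConst hw a (two_zpow_pos 0)
  rw [← ha] at h0 ht h1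
  have h2 : ∫⁻ x in gridCube hD 0 0, ENNReal.ofReal (w x) ≤
      ∫⁻ x in gridCube hD 0 0, maximalFn ((gridCube hD 0 0).indicator w) x := by
    rw [← setLAverage_mul_volume (volume_ne_zero_of_mem_level hQ)
      (volume_ne_top_of_mem_level hQ), ← setLIntegral_const]
    exact setLIntegral_mono' (measurableSet_of_mem_level hQ) fun x hx =>
      setLAverage_le_maximalFn hQ hx
  have h3 := h2.trans h1
  nth_rewrite 1 [← one_mul (∫⁻ x in gridCube hD 0 0, ENNReal.ofReal (w x))] at h3
  exact (ENNReal.mul_le_mul_iff_left h0 ht).1 h3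

theorem apConst_ne_zero {p : ℝ} (hp : 1 ≤ p) {w : (Fin n → ℝ) → ℝ} (hw : IsWeight w) :
    apConst p w ≠ 0 := by
  intro h
  have h1 := setLAverage_mul_rpow_le_apConst hp hw (F := fun _ => 1) aemeasurable_const 0 one_pos
  rw [h, zero_mul, setLAverage_one (volume_cube_ne_zero 0 one_pos) (volume_cube_ne_top 0 1),
    ENNReal.one_rpow, mul_one, nonpos_iff_eq_zero] at h1
  exact setLAverage_cube_ofReal_ne_zero hw 0 one_pos h1

theorem lintegral_rpow_le_of_ainftyConst (hD : IsDyadicGrid D) {w : (Fin n → ℝ) → ℝ}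
    (hw : IsWeight w) {A : ℝ≥0} (hA : ainftyConst w = A) {ε : ℝ}
    (hε : ε = 1 / (4 * (n + 1 : ℝ) * A)) {Q : Set (Fin n → ℝ)} (hQ : Q ∈ D) :
    ∫⁻ x in Q, ENNReal.ofReal (w x) ^ (1 + ε) ≤
      2 * (⨍⁻ x in Q, ENNReal.ofReal (w x) ∂volume) ^ ε * ∫⁻ x in Q, ENNReal.ofReal (w x) := by
  have hA1 : 1 ≤ A := by
    have := one_le_ainftyConst hD hw
    rw [hA] at this
    exact_mod_cast this
  have hA0 : 0 < A := lt_of_lt_of_le one_pos hA1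
  have hA1' : (1 : ℝ) ≤ A := by exact_mod_cast hA1
  have hA0' : (0 : ℝ) < A := by exact_mod_cast hA0
  have hn : (0 : ℝ) ≤ n := n.cast_nonneg
  have hε0 : 0 ≤ ε := by rw [hε]; positivity
  have hs : ((n + 1 : ℕ) : ℝ) * ε = 1 / (4 * A) := by
    rw [hε]; push_cast; field_simp
  have hs1 : 1 / (4 * (A : ℝ)) ≤ 1 := by
    rw [div_le_one (by positivity)]
    linarith
  have hβr : (2 : ℝ) ^ (1 / (4 * (A : ℝ))) ≤ 1 + 1 / (4 * A) := by
    have := rpow_one_add_le_one_add_mul_self (s := 1) (by norm_num)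
      (by positivity : 0 ≤ 1 / (4 * (A : ℝ))) hs1
    norm_num at this ⊢
    exact this
  -- The value of `ε` makes `(2^{n+1})^ε` equal to `2^{1/(4A)}`, which Bernoulli bounds by `1 +
  -- 1/(4A)`.
  refine lintegral_rpow_le_of_fujiiWilson hD hw hA0 hε0 (β := (2 : ℝ≥0) ^ (1 / (4 * (A : ℝ))))
    ?_ ?_ ?_ hQ
  · rw [← ENNReal.rpow_natCast, ← ENNReal.rpow_mul, hs,
      ENNReal.coe_rpow_of_nonneg _ (by positivity)]
    simp
  · rw [← NNReal.coe_le_coe]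
    push_cast
    calc 4 * (A : ℝ) * 2 ^ (1 / (4 * (A : ℝ))) ≤ 4 * A * (1 + 1 / (4 * A)) := by gcongr
      _ = _ := by field_simp
  · intro P hP
    obtain ⟨k, -, a, rfl⟩ := hD.exists_mem_level hP
    rw [← hA]
    exact lintegral_maximalFn_le_ainftyConst hw a (two_zpow_pos k)

theorem volume_lt_tsum_le (hD : IsDyadicGrid D) {S : Set (Set (Fin n → ℝ))} (hS : S ⊆ D)
    (hsp : IsSparse S) {p : ℝ} (hp : 1 ≤ p) {w : (Fin n → ℝ) → ℝ} (hw : IsWeight w) {A : ℝ≥0}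
    (hA : ainftyConst w = A) {a : Set (Fin n → ℝ) → ℝ≥0∞} {H : (Fin n → ℝ) → ℝ≥0∞}
    (haH : ∀ Q ∈ S, (⨍⁻ x in Q, ENNReal.ofReal (w x) ∂volume) * a Q ^ p ≤
      ⨍⁻ x in Q, H x ∂volume) :
    volume {x | 1 < ENNReal.ofReal (w x) ^ (1 / p) *
      ∑' Q : S, (Q : Set (Fin n → ℝ)).indicator (fun _ => a Q) x} ≤
      weakConst n p * (A : ℝ≥0∞) ^ p * ∫⁻ x, H x := by
  classical
  obtain ⟨E, hE, hd⟩ := hsp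
  have hA1 : 1 ≤ A := by
    have := one_le_ainftyConst hD hw
    rw [hA] at this
    exact_mod_cast this
  have hA0 : (0 : ℝ) < A := by exact_mod_cast lt_of_lt_of_le one_pos hA1
  obtain ⟨ε, hε⟩ : ∃ ε : ℝ, ε = 1 / (4 * (n + 1 : ℝ) * A) := ⟨_, rfl⟩
  have hε0 : 0 < ε := by rw [hε]; positivity
  have hε1 : ε ≤ 1 := by
    have hA1' : (1 : ℝ) ≤ A := by exact_mod_cast hA1
    have hn : (0 : ℝ) ≤ n := n.cast_nonneg
    rw [hε, div_le_one (by positivity)]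
    nlinarith
  have hc : Countable S := (hD.countable.mono hS).to_subtype
  have hU : {x | 1 < ENNReal.ofReal (w x) ^ (1 / p) *
      ∑' Q : S, (Q : Set (Fin n → ℝ)).indicator (fun _ => a Q) x} =
      ⋃ F : Finset S, {x | 1 < ENNReal.ofReal (w x) ^ (1 / p) *
        ∑ Q ∈ F, (Q : Set (Fin n → ℝ)).indicator (fun _ => a Q) x} := by
    ext x
    rw [mem_iUnion, mem_ofPred_eq, ENNReal.tsum_eq_iSup_sum, ENNReal.mul_iSup, lt_iSup_iff]
    rfl
  have hdir : Directed (· ⊆ ·) fun F : Finset S => {x | 1 < ENNReal.ofReal (w x) ^ (1 / p) *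
        ∑ Q ∈ F, (Q : Set (Fin n → ℝ)).indicator (fun _ => a Q) x} := by
    refine Monotone.directed_le fun F G hFG x hx => ?_
    rw [mem_ofPred_eq] at hx ⊢
    refine hx.trans_le ?_
    gcongr
  -- The finite estimates are uniform, so continuity of the measure along the directed union reaches
  -- infinite families.
  rw [hU, hdir.measure_iUnion]
  refine iSup_le fun F => ?_
  have hsum : ∀ x, ∑ Q ∈ F, (Q : Set (Fin n → ℝ)).indicator (fun _ => a Q) x =
      ∑ Q ∈ F.map (Function.Embedding.subtype _), Q.indicator (fun _ => a Q) x := fun x => by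
    rw [Finset.sum_map]
    rfl
  simp only [hsum]
  have hF : ↑(F.map (Function.Embedding.subtype (· ∈ S))) ⊆ S := by
    intro Q hQ
    obtain ⟨P, -, rfl⟩ := Finset.mem_map.1 (Finset.mem_coe.1 hQ)
    exact P.2
  refine (volume_lt_sum_le hD hS hE hd hp hε0 hw.aemeasurable_ofReal
    (fun Q hQ => lintegral_rpow_le_of_ainftyConst hD hw hA hε (hS hQ))
    -- The recursion needs `K ≥ 2q`, and `ε ≤ 1` gives `q ≤ 2p`.
    (one_add_mul_half_rpow_le (K := 4 * p) (by nlinarith) (by nlinarith)) ?_ haH hF).trans ?_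
  · intro Q hQ
    obtain ⟨k, -, b, rfl⟩ := hD.exists_mem_level (hS hQ)
    exact setLAverage_cube_ofReal_ne_zero hw b (two_zpow_pos k)
  · gcongr
    exact sparse_factor_le hp hA1 hε

/-! ### Almost everywhere convergence of the sparse sum -/

/-- Test the `A_p` inequality on the indicator of `Q \ P`, with `P` a child of `Q`. It fills at
least half of `Q`, so `2^{-p} w(Q) ≤ [w]_{A_p} w(Q \ P)`, and `P` misses a fixed proportion of
`w(Q)`. -/
theorem exists_lt_one_lintegral_gridCube_le (hn : 1 ≤ n) (hD : IsDyadicGrid D) {p : ℝ}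
    (hp : 1 ≤ p) {w : (Fin n → ℝ) → ℝ} (hw : MemAp p w) (x : Fin n → ℝ) :
    ∃ ρ : ℝ≥0∞, ρ < 1 ∧ ∀ k : ℤ, ∫⁻ y in gridCube hD k x, ENNReal.ofReal (w y) ≤
      ρ * ∫⁻ y in gridCube hD (k + 1) x, ENNReal.ofReal (w y) := by
  have hp0 : 0 < p := by linarith
  set B := apConst p w with hB
  have hB0 : B ≠ 0 := apConst_ne_zero hp hw.1
  have hBt : B ≠ ∞ := hw.2.ne
  have hδ0 : (1 / 2 : ℝ≥0∞) ^ p ≠ 0 := by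
    rw [Ne, ENNReal.rpow_eq_zero_iff_of_pos hp0]
    simp
  refine ⟨(B - (1 / 2) ^ p) / B, ?_, fun k => ?_⟩
  · rw [ENNReal.div_lt_iff (Or.inl hB0) (Or.inl hBt), one_mul]
    exact ENNReal.sub_lt_self hBt hB0 hδ0
  set P := gridCube hD k x with hP
  set Q := gridCube hD (k + 1) x with hQ
  have hPl := hD.gridCube_mem_level k x
  have hQl := hD.gridCube_mem_level (k + 1) x
  have hPQ : P ⊆ Q := hD.gridCube_subset_succ k x
  have hPm : MeasurableSet P := measurableSet_of_mem_level hPl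
  have hQm : MeasurableSet Q := measurableSet_of_mem_level hQl
  have hv0 : volume Q ≠ 0 := volume_ne_zero_of_mem_level hQl
  have hvt : volume Q ≠ ∞ := volume_ne_top_of_mem_level hQl
  obtain ⟨b, hb⟩ := hQl.2
  set U := ∫⁻ y in Q, ENNReal.ofReal (w y) with hU
  have hUt : U ≠ ∞ := by
    rw [hU, hQ, hb]
    exact (lintegral_cube_ofReal_lt_top hw.1.1 b (two_zpow_pos _).le).ne
  have hhalf : 1 / 2 ≤ ⨍⁻ y in Q, (Q \ P).indicator (fun _ => 1) y ∂volume := by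
    rw [setLAverage_eq, ENNReal.le_div_iff_mul_le (Or.inl hv0) (Or.inl hvt),
      lintegral_indicator (hQm.diff hPm), Measure.restrict_restrict (hQm.diff hPm),
      inter_eq_left.2 sdiff_subset, setLIntegral_const, one_mul,
      measure_sdiff hPQ hPm.nullMeasurableSet (volume_ne_top_of_mem_level hPl)]
    refine ENNReal.le_sub_of_add_le_left (volume_ne_top_of_mem_level hPl) ?_
    have h1 : volume P ≤ 1 / 2 * volume Q := by
      rw [volume_level_succ hQl hPl, ← mul_assoc]
      refine le_mul_of_one_le_left' ?_
      calc (1 : ℝ≥0∞) = 1 / 2 * 2 ^ 1 := by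
            rw [pow_one, ENNReal.div_mul_cancel two_ne_zero ENNReal.ofNat_ne_top]
        _ ≤ 1 / 2 * 2 ^ n := by
            gcongr
            exact one_le_two
    calc volume P + 1 / 2 * volume Q ≤ 1 / 2 * volume Q + 1 / 2 * volume Q := by gcongr
      _ = volume Q := by rw [← add_mul, ENNReal.add_halves, one_mul]
  have hA := setLAverage_mul_rpow_le_apConst hp hw.1 (F := (Q \ P).indicator fun _ => 1)
    (aemeasurable_const.indicator (hQm.diff hPm)) b (two_zpow_pos (k + 1))
  rw [← hb, ← hQ, ← hB] at hA
  have hind : ∀ y, (Q \ P).indicator (fun _ => (1 : ℝ≥0∞)) y ^ p * ENNReal.ofReal (w y) =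
      (Q \ P).indicator (fun y => ENNReal.ofReal (w y)) y := by
    intro y
    by_cases hy : y ∈ Q \ P
    · rw [indicator_of_mem hy, indicator_of_mem hy, ENNReal.one_rpow, one_mul]
    · rw [indicator_of_notMem hy, indicator_of_notMem hy, ENNReal.zero_rpow_of_pos hp0, zero_mul]
  simp only [hind] at hA
  have hA2 : U * (1 / 2) ^ p ≤ B * ∫⁻ y in Q \ P, ENNReal.ofReal (w y) := by
    have h1 := mul_le_mul_left (((mul_le_mul_right
      (ENNReal.rpow_le_rpow hhalf hp0.le) _).trans hA)) (volume Q)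
    rw [mul_right_comm, setLAverage_mul_volume hv0 hvt, mul_assoc, setLAverage_mul_volume hv0 hvt,
      lintegral_indicator (hQm.diff hPm), Measure.restrict_restrict (hQm.diff hPm),
      inter_eq_left.2 sdiff_subset] at h1
    exact h1
  have hsplit : (∫⁻ y in P, ENNReal.ofReal (w y)) + ∫⁻ y in Q \ P, ENNReal.ofReal (w y) = U := by
    rw [← lintegral_inter_add_sdiff (fun y => ENNReal.ofReal (w y)) Q hPm,
      inter_eq_right.2 hPQ] at hU
    exact hU.symm
  rw [ENNReal.mul_comm_div, ← mul_div_assoc, ENNReal.le_div_iff_mul_le (Or.inl hB0) (Or.inl hBt),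
    ENNReal.sub_mul (fun _ _ => hUt)]
  refine ENNReal.le_sub_of_add_le_left (ENNReal.mul_ne_top
    (ENNReal.rpow_ne_top_of_nonneg hp0.le (by simp)) hUt) ?_
  calc _ = U * (1 / 2) ^ p + B * ∫⁻ y in P, ENNReal.ofReal (w y) := by ring
    _ ≤ B * (∫⁻ y in Q \ P, ENNReal.ofReal (w y)) + B * ∫⁻ y in P, ENNReal.ofReal (w y) := by
        gcongr
    _ = B * U := by rw [← mul_add, add_comm, hsplit]

theorem setLAverage_ne_top {p : ℝ} (hp : 1 ≤ p) {w : (Fin n → ℝ) → ℝ} (hw : MemAp p w)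
    {F : (Fin n → ℝ) → ℝ≥0∞} (hF : AEMeasurable F volume)
    (hFp : ∫⁻ x, F x ^ p * ENNReal.ofReal (w x) ≠ ∞) (a : Fin n → ℝ) {l : ℝ} (hl : 0 < l) :
    ⨍⁻ x in cube a l, F x ∂volume ≠ ∞ := by
  have hp0 : 0 < p := by linarith
  intro h
  have h1 := setLAverage_mul_rpow_le_apConst hp hw.1 hF a hl
  rw [h, ENNReal.top_rpow_of_pos hp0,
    ENNReal.mul_top (setLAverage_cube_ofReal_ne_zero hw.1 a hl), top_le_iff] at h1
  refine ENNReal.mul_ne_top hw.2.ne ?_ h1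
  rw [setLAverage_eq]
  exact ENNReal.div_ne_top (ne_top_of_le_ne_top hFp (setLIntegral_le_lintegral _ _))
    (volume_cube_ne_zero a hl)

/-- The `A_p` inequality bounds `⟨F⟩_Q^p` by a constant over `w(Q)`, and `w(Q)` grows geometrically
along the ancestors of a point. -/
theorem tsum_setLAverage_gridCube_ne_top (hn : 1 ≤ n) (hD : IsDyadicGrid D) {p : ℝ} (hp : 1 ≤ p)
    {w : (Fin n → ℝ) → ℝ} (hw : MemAp p w) {F : (Fin n → ℝ) → ℝ≥0∞} (hF : AEMeasurable F volume)
    (hFp : ∫⁻ x, F x ^ p * ENNReal.ofReal (w x) ≠ ∞) (x : Fin n → ℝ) :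
    ∑' k : ℕ, ⨍⁻ y in gridCube hD k x, F y ∂volume ≠ ∞ := by
  have hp0 : 0 < p := by linarith
  obtain ⟨ρ, hρ, hgrow⟩ := exists_lt_one_lintegral_gridCube_le hn hD hp hw x
  set W : ℤ → ℝ≥0∞ := fun k => ∫⁻ y in gridCube hD k x, ENNReal.ofReal (w y) with hW
  set I := ∫⁻ x, F x ^ p * ENNReal.ofReal (w x) with hI
  have hpow : ∀ k : ℕ, W 0 ≤ ρ ^ k * W k := by
    intro k
    induction k with
    | zero => simp
    | succ k ih =>
      calc W 0 ≤ ρ ^ k * W k := ih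
        _ ≤ ρ ^ k * (ρ * W (k + 1)) := by gcongr; exact hgrow k
        _ = ρ ^ (k + 1) * W (k + 1 : ℕ) := by push_cast; ring
  have hAp : ∀ k : ℤ, W k * (⨍⁻ y in gridCube hD k x, F y ∂volume) ^ p ≤ apConst p w * I := by
    intro k
    have hl := hD.gridCube_mem_level k x
    obtain ⟨b, hb⟩ := hl.2
    have hv0 := volume_ne_zero_of_mem_level hl
    have hvt := volume_ne_top_of_mem_level hl
    have h1 := setLAverage_mul_rpow_le_apConst hp hw.1 hF b (two_zpow_pos k)
    rw [← hb] at h1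
    have h2 := mul_le_mul_left h1 (volume (gridCube hD k x))
    rw [mul_right_comm, setLAverage_mul_volume hv0 hvt, mul_assoc,
      setLAverage_mul_volume hv0 hvt] at h2
    refine h2.trans ?_
    gcongr
    exact setLIntegral_le_lintegral _ _
  obtain ⟨b, hb⟩ := (hD.gridCube_mem_level 0 x).2
  have hW0 : W 0 ≠ 0 := by
    simp only [hW, hb]
    exact lintegral_cube_ofReal_ne_zero hw.1 b (two_zpow_pos 0)
  have hW0t : W 0 ≠ ∞ := by
    simp only [hW, hb]
    exact (lintegral_cube_ofReal_lt_top hw.1.1 b (two_zpow_pos 0).le).ne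
  set R := (apConst p w * I / W 0) ^ (1 / p) with hR
  have hRt : R ≠ ∞ := by
    refine ENNReal.rpow_ne_top_of_nonneg (by positivity) ?_
    exact ENNReal.div_ne_top (ENNReal.mul_ne_top hw.2.ne hFp) hW0
  have hterm : ∀ k : ℕ, ⨍⁻ y in gridCube hD k x, F y ∂volume ≤ R * (ρ ^ (1 / p)) ^ k := by
    intro k
    set v := ⨍⁻ y in gridCube hD k x, F y ∂volume with hv
    have h1 : v ^ p ≤ apConst p w * I / W 0 * ρ ^ k := by
      rw [ENNReal.mul_comm_div, ← mul_div_assoc,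
        ENNReal.le_div_iff_mul_le (Or.inl hW0) (Or.inl hW0t)]
      calc v ^ p * W 0 ≤ v ^ p * (ρ ^ k * W k) := by gcongr; exact hpow k
        _ = W k * v ^ p * ρ ^ k := by ring
        _ ≤ apConst p w * I * ρ ^ k := mul_le_mul_left (hAp k) _
    have h2 := ENNReal.rpow_le_rpow h1 (by positivity : 0 ≤ 1 / p)
    rw [← ENNReal.rpow_mul, mul_one_div_cancel hp0.ne', ENNReal.rpow_one,
      ENNReal.mul_rpow_of_nonneg _ _ (by positivity), ← ENNReal.rpow_natCast, ← ENNReal.rpow_mul,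
      mul_comm (k : ℝ), ENNReal.rpow_mul, ENNReal.rpow_natCast] at h2
    exact h2
  have hρ1 : ρ ^ (1 / p) < 1 := ENNReal.rpow_lt_one hρ (by positivity)
  refine ne_top_of_le_ne_top ?_ (ENNReal.tsum_le_tsum hterm)
  rw [ENNReal.tsum_mul_left, ENNReal.tsum_geometric]
  exact ENNReal.mul_ne_top hRt (ENNReal.inv_ne_top.2 (tsub_pos_of_lt hρ1).ne')

/-- Borel-Cantelli inside each unit cube `P`: by sparseness the volumes of the members contained in
`P` sum to at most `2|P|`. -/
theorem ae_finite_small_cubes (hD : IsDyadicGrid D) {S : Set (Set (Fin n → ℝ))} (hS : S ⊆ D)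
    (hsp : IsSparse S) : ∀ᵐ x, {Q : S | x ∈ (Q : Set (Fin n → ℝ)) ∧
      (Q : Set (Fin n → ℝ)) ⊆ gridCube hD 0 x}.Finite := by
  obtain ⟨E, hE, hd⟩ := hsp
  have hloc : ∀ P ∈ level D 0, ∀ᵐ x,
      {Q : {Q : S // (Q : Set (Fin n → ℝ)) ⊆ P} | x ∈ (Q.1 : Set (Fin n → ℝ))}.Finite := by
    intro P hP
    have hc : Countable S := (hD.countable.mono hS).to_subtype
    refine ae_finite_setOfPred_mem ?_
    refine ne_top_of_le_ne_top (ENNReal.mul_ne_top ENNReal.ofNat_ne_top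
      (volume_ne_top_of_mem_level hP)) (b := 2 * volume P) ?_
    calc ∑' Q : {Q : S // (Q : Set (Fin n → ℝ)) ⊆ P}, volume (Q.1 : Set (Fin n → ℝ))
        ≤ ∑' Q : {Q : S // (Q : Set (Fin n → ℝ)) ⊆ P}, 2 * volume (E Q.1) :=
          ENNReal.tsum_le_tsum fun Q => (hE Q.1 Q.1.2).2.2
      _ = 2 * volume (⋃ Q : {Q : S // (Q : Set (Fin n → ℝ)) ⊆ P}, E Q.1) := by
          rw [ENNReal.tsum_mul_left, measure_iUnion
            (f := fun Q : {Q : S // (Q : Set (Fin n → ℝ)) ⊆ P} => E Q.1) _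
            fun Q => (hE Q.1 Q.1.2).1]
          intro Q R hQR
          exact hd Q.1.2 R.1.2 fun h => hQR (Subtype.ext (Subtype.ext h))
      _ ≤ 2 * volume P := by
          gcongr
          exact iUnion_subset fun Q => (hE Q.1 Q.1.2).2.1.trans Q.2
  filter_upwards [(ae_ball_iff (hD.level_countable 0)).2 hloc] with x hx
  refine ((hx _ (hD.gridCube_mem_level 0 x)).image Subtype.val).subset ?_
  rintro Q ⟨hQ1, hQ2⟩
  exact ⟨⟨Q, hQ2⟩, hQ1, rfl⟩

theorem ae_tsum_setLAverage_ne_top (hn : 1 ≤ n) (hD : IsDyadicGrid D)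
    {S : Set (Set (Fin n → ℝ))} (hS : S ⊆ D) (hsp : IsSparse S) {p : ℝ} (hp : 1 ≤ p)
    {w : (Fin n → ℝ) → ℝ} (hw : MemAp p w) {F : (Fin n → ℝ) → ℝ≥0∞} (hF : AEMeasurable F volume)
    (hFp : ∫⁻ x, F x ^ p * ENNReal.ofReal (w x) ≠ ∞) :
    ∀ᵐ x, ∑' Q : S, (Q : Set (Fin n → ℝ)).indicator
      (fun _ => ⨍⁻ y in (Q : Set (Fin n → ℝ)), F y ∂volume) x ≠ ∞ := by
  classical
  filter_upwards [ae_finite_small_cubes hD hS hsp] with x hx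
  set v : Set (Fin n → ℝ) → ℝ≥0∞ := fun Q => ⨍⁻ y in Q, F y ∂volume with hv
  have hvt : ∀ Q ∈ D, v Q ≠ ∞ := by
    intro Q hQ
    obtain ⟨k, -, b, rfl⟩ := hD.exists_mem_level hQ
    exact setLAverage_ne_top hp hw hF hFp b (two_zpow_pos k)
  -- Each sparse cube through `x` either lies in the unit grid cube of `x`, leaving a finite sum, or
  -- is one of the ancestors of that cube, each of which is counted at most once.
  have hle : ∀ Q : S, (Q : Set (Fin n → ℝ)).indicator (fun _ => v Q) x ≤
      (if Q ∈ hx.toFinset then v Q else 0) +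
        ∑' k : ℕ, if (Q : Set (Fin n → ℝ)) = gridCube hD k x then v (gridCube hD k x) else 0 := by
    intro Q
    by_cases hxQ : x ∈ (Q : Set (Fin n → ℝ))
    · rw [indicator_of_mem hxQ]
      obtain ⟨k, hk⟩ := hD.exists_mem_level (hS Q.2)
      have hQk := hD.eq_gridCube hk hxQ
      rcases le_or_gt k 0 with h | h
      · have hmem : Q ∈ hx.toFinset := by
          rw [Set.Finite.mem_toFinset]
          refine ⟨hxQ, ?_⟩
          rw [hQk]
          exact hD.gridCube_mono x h
        rw [if_pos hmem]
        exact le_self_add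
      · lift k to ℕ using h.le
        refine le_add_left ((le_of_eq ?_).trans (ENNReal.le_tsum k))
        rw [if_pos hQk, ← hQk]
    · rw [indicator_of_notMem hxQ]
      exact zero_le
  refine ne_top_of_le_ne_top ?_ (ENNReal.tsum_le_tsum hle)
  rw [ENNReal.tsum_add]
  refine ENNReal.add_ne_top.2 ⟨?_, ?_⟩
  · rw [tsum_eq_sum (s := hx.toFinset) fun Q hQ => if_neg hQ]
    refine (ENNReal.sum_lt_top.2 fun Q _ => ?_).ne
    split_ifs
    exact (hvt Q (hS Q.2)).lt_top
  · rw [ENNReal.tsum_comm]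
    refine ne_top_of_le_ne_top (tsum_setLAverage_gridCube_ne_top hn hD hp hw hF hFp x)
      (ENNReal.tsum_le_tsum fun k => ?_)
    refine (ENNReal.tsum_comp_le_tsum_of_injective Subtype.val_injective
      (fun Q : Set (Fin n → ℝ) =>
        if Q = gridCube hD k x then v (gridCube hD k x) else 0)).trans_eq ?_
    exact tsum_ite_eq _ _

/-! ### The weighted weak type estimate -/

theorem enorm_setAverage_le (f : (Fin n → ℝ) → ℝ) (Q : Set (Fin n → ℝ)) :
    ‖⨍ y in Q, f y‖ₑ ≤ ⨍⁻ y in Q, ‖f y‖ₑ ∂volume := by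
  rw [setLAverage_eq', setAverage_eq']
  exact enorm_integral_le_lintegral_enorm _

theorem ae_enorm_mul_rpow_eq {p : ℝ} (hp : 1 ≤ p) {w : (Fin n → ℝ) → ℝ} (hw : IsWeight w)
    (f : (Fin n → ℝ) → ℝ) :
    ∀ᵐ x, ‖f x * w x ^ (-(1 / p))‖ₑ ^ p * ENNReal.ofReal (w x) = ‖f x‖ₑ ^ p := by
  have hp0 : 0 < p := by linarith
  filter_upwards [hw.2] with x hx
  have hx0 : ENNReal.ofReal (w x) ≠ 0 := by simpa using hx
  rw [enorm_mul, Real.enorm_of_nonneg (Real.rpow_nonneg hx.le _), ← ENNReal.ofReal_rpow_of_pos hx,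
    ENNReal.mul_rpow_of_nonneg _ _ hp0.le, ← ENNReal.rpow_mul, neg_mul,
    one_div_mul_cancel hp0.ne', ENNReal.rpow_neg_one, mul_assoc,
    ENNReal.inv_mul_cancel hx0 ENNReal.ofReal_ne_top, mul_one]

theorem eLpNorm_rpow_eq {p : ℝ} (hp : 1 ≤ p) (f : (Fin n → ℝ) → ℝ) :
    eLpNorm f (ENNReal.ofReal p) volume ^ p = ∫⁻ x, ‖f x‖ₑ ^ p := by
  have hp0 : 0 < p := by linarith
  rw [eLpNorm_eq_lintegral_rpow_enorm_toReal (by simpa using hp0) ENNReal.ofReal_ne_top,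
    ENNReal.toReal_ofReal hp0.le, ← ENNReal.rpow_mul, one_div_mul_cancel hp0.ne',
    ENNReal.rpow_one]

theorem sparseOp_eq_zero {S : Set (Set (Fin n → ℝ))} {g : (Fin n → ℝ) → ℝ}
    (hg : g =ᵐ[volume] 0) (x : Fin n → ℝ) : sparseOp S g x = 0 := by
  have h : ∀ Q : Set (Fin n → ℝ), ⨍ y in Q, g y = 0 := fun Q => by
    rw [setAverage_eq, integral_congr_ae (ae_restrict_of_ae hg)]
    simp
  simp [sparseOp, h]

theorem enorm_sparseOp_le (S : Set (Set (Fin n → ℝ))) (g : (Fin n → ℝ) → ℝ) (x : Fin n → ℝ) :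
    ‖sparseOp S g x‖ₑ ≤ ∑' Q : S, (Q : Set (Fin n → ℝ)).indicator
      (fun _ => ⨍⁻ y in (Q : Set (Fin n → ℝ)), ‖g y‖ₑ ∂volume) x := by
  refine enorm_tsum_le_tsum_enorm.trans (ENNReal.tsum_le_tsum fun Q => ?_)
  rw [enorm_indicator_eq_indicator_enorm]
  exact indicator_le_indicator (enorm_setAverage_le g Q)

theorem volume_lt_sparseOp_le (hD : IsDyadicGrid D) {S : Set (Set (Fin n → ℝ))} (hS : S ⊆ D)
    (hsp : IsSparse S) {p : ℝ} (hp : 1 ≤ p) {w : (Fin n → ℝ) → ℝ} (hw : MemAp p w)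
    {f : (Fin n → ℝ) → ℝ} (hf : AEStronglyMeasurable f volume) {t : ℝ} (ht : 0 < t) :
    volume {x | t < |w x ^ (1 / p) * sparseOp S (fun y => f y * w y ^ (-(1 / p))) x|} ≤
      weakConst n p * apConst p w * ainftyConst w ^ p *
        (eLpNorm f (ENNReal.ofReal p) volume / ENNReal.ofReal t) ^ p := by
  have hp0 : 0 < p := by linarith
  set g : (Fin n → ℝ) → ℝ := fun y => f y * w y ^ (-(1 / p)) with hg
  set τ := ENNReal.ofReal t with hτ
  have hτ0 : τ ≠ 0 := by simpa [hτ] using ht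
  have hτt : τ ≠ ∞ := ENNReal.ofReal_ne_top
  -- Finiteness of the Fujii-Wilson characteristic is not needed: if it is infinite, so is the
  -- bound, unless `f = 0` almost everywhere and the operator vanishes identically.
  rcases eq_or_ne (ainftyConst w) ∞ with hA | hA
  · rcases eq_or_ne (eLpNorm f (ENNReal.ofReal p) volume) 0 with h0 | h0
    · rw [eLpNorm_eq_zero_iff hf (by simpa using hp0)] at h0
      have hg0 : g =ᵐ[volume] 0 := h0.mono fun x hx => by simp [hg, hx]
      simp only [sparseOp_eq_zero hg0, mul_zero, abs_zero, not_lt.2 ht.le]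
      simp
    · have h1 : (weakConst n p : ℝ≥0∞) * apConst p w ≠ 0 :=
        mul_ne_zero (by simpa using weakConst_ne_zero n hp) (apConst_ne_zero hp hw.1)
      have h2 : (eLpNorm f (ENNReal.ofReal p) volume / τ) ^ p ≠ 0 := by
        rw [Ne, ENNReal.rpow_eq_zero_iff_of_pos hp0]
        exact ENNReal.div_ne_zero.2 ⟨h0, hτt⟩
      rw [hA, ENNReal.top_rpow_of_pos hp0, ENNReal.mul_top h1, ENNReal.top_mul h2]
      exact le_top
  · obtain ⟨A, hA⟩ : ∃ A : ℝ≥0, ainftyConst w = A := ⟨_, (ENNReal.coe_toNNReal hA).symm⟩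
    have hgm : AEMeasurable (fun x => ‖g x‖ₑ) volume :=
      (hf.aemeasurable.mul (hw.1.1.aestronglyMeasurable.aemeasurable.pow_const _)).enorm
    set c := apConst p w / τ ^ p with hc
    have hct : c ≠ ∞ := ENNReal.div_ne_top hw.2.ne
      (by rw [Ne, ENNReal.rpow_eq_zero_iff_of_pos hp0]; exact hτ0)
    -- The level `t` and the `A_p` characteristic are absorbed into `H`, which reduces the claim to
    -- the level set at height one.
    set H : (Fin n → ℝ) → ℝ≥0∞ := fun x => c * (‖g x‖ₑ ^ p * ENNReal.ofReal (w x)) with hH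
    have haH : ∀ Q ∈ S, (⨍⁻ x in Q, ENNReal.ofReal (w x) ∂volume) *
        ((⨍⁻ x in Q, ‖g x‖ₑ ∂volume) / τ) ^ p ≤ ⨍⁻ x in Q, H x ∂volume := by
      intro Q hQ
      obtain ⟨k, -, b, rfl⟩ := hD.exists_mem_level (hS hQ)
      have h1 := setLAverage_mul_rpow_le_apConst hp hw.1 hgm b (two_zpow_pos k)
      have h2 : ⨍⁻ x in cube b (2 ^ k), H x ∂volume =
          c * ⨍⁻ x in cube b (2 ^ k), ‖g x‖ₑ ^ p * ENNReal.ofReal (w x) ∂volume := by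
        rw [setLAverage_eq, setLAverage_eq, hH, lintegral_const_mul' _ _ hct, mul_div_assoc]
      rw [h2, hc, ENNReal.div_rpow_of_nonneg _ _ hp0.le, ← mul_div_assoc, ENNReal.mul_comm_div,
        ← mul_div_assoc]
      exact ENNReal.div_le_div_right h1 _
    have hint : ∫⁻ x, H x =
        apConst p w * (eLpNorm f (ENNReal.ofReal p) volume / τ) ^ p := by
      rw [hH, lintegral_const_mul' _ _ hct, lintegral_congr_ae (ae_enorm_mul_rpow_eq hp hw.1 f),
        ENNReal.div_rpow_of_nonneg _ _ hp0.le, eLpNorm_rpow_eq hp, hc, ENNReal.mul_comm_div]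
    have hsub : {x | t < |w x ^ (1 / p) * sparseOp S g x|} ≤ᵐ[volume]
        {x | 1 < ENNReal.ofReal (w x) ^ (1 / p) * ∑' Q : S, (Q : Set (Fin n → ℝ)).indicator
          (fun _ => (⨍⁻ x in (Q : Set (Fin n → ℝ)), ‖g x‖ₑ ∂volume) / τ) x} := by
      filter_upwards [hw.1.2] with x hx hxt
      have hxt' : t < |w x ^ (1 / p) * sparseOp S g x| := hxt
      have h1 : τ < ‖w x ^ (1 / p) * sparseOp S g x‖ₑ := by
        rw [Real.enorm_eq_ofReal_abs]
        exact (ENNReal.ofReal_lt_ofReal_iff_of_nonneg ht.le).2 hxt'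
      rw [enorm_mul, Real.enorm_of_nonneg (Real.rpow_nonneg hx.le _),
        ← ENNReal.ofReal_rpow_of_pos hx] at h1
      have h2 := h1.trans_le (mul_le_mul_right (enorm_sparseOp_le S g x) _)
      have h3 : ∀ Q : S, (Q : Set (Fin n → ℝ)).indicator
          (fun _ => (⨍⁻ x in (Q : Set (Fin n → ℝ)), ‖g x‖ₑ ∂volume) / τ) x =
          (Q : Set (Fin n → ℝ)).indicator
          (fun _ => ⨍⁻ x in (Q : Set (Fin n → ℝ)), ‖g x‖ₑ ∂volume) x * τ⁻¹ := by
        intro Q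
        by_cases hxQ : x ∈ (Q : Set (Fin n → ℝ))
        · rw [indicator_of_mem hxQ, indicator_of_mem hxQ, div_eq_mul_inv]
        · rw [indicator_of_notMem hxQ, indicator_of_notMem hxQ, zero_mul]
      change 1 < _
      simp only [h3]
      rw [ENNReal.tsum_mul_right, ← mul_assoc, ← div_eq_mul_inv,
        ENNReal.lt_div_iff_mul_lt (Or.inl hτ0) (Or.inl hτt), one_mul]
      exact h2
    calc _ ≤ _ := measure_mono_ae hsub
      _ ≤ weakConst n p * (A : ℝ≥0∞) ^ p * ∫⁻ x, H x :=
          volume_lt_tsum_le hD hS hsp hp hw.1 hA haH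
      _ = _ := by rw [hint, hA]; ring

theorem locallyIntegrable_mul_rpow {p : ℝ} (hp : 1 ≤ p) {w : (Fin n → ℝ) → ℝ} (hw : MemAp p w)
    {f : (Fin n → ℝ) → ℝ} (hf : MemLp f (ENNReal.ofReal p) volume) :
    LocallyIntegrable (fun y => f y * w y ^ (-(1 / p))) volume := by
  have hp0 : 0 < p := by linarith
  have hgm : AEMeasurable (fun y => f y * w y ^ (-(1 / p))) volume :=
    hf.1.aemeasurable.mul (hw.1.1.aestronglyMeasurable.aemeasurable.pow_const _)
  intro x
  -- A half-open cube is a neighbourhood of its centre, and finite averages over cubes then give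
  -- local integrability.
  refine ⟨cube (fun i => x i - 1) 2, ?_, hgm.aestronglyMeasurable.restrict, ?_⟩
  · rw [cube]
    refine set_pi_mem_nhds finite_univ fun i _ => ?_
    exact Ico_mem_nhds (by linarith) (by linarith)
  · have h := setLAverage_ne_top hp hw hgm.enorm (by
      rw [lintegral_congr_ae (ae_enorm_mul_rpow_eq hp hw.1 f), ← eLpNorm_rpow_eq hp]
      exact ENNReal.rpow_ne_top_of_nonneg hp0.le hf.2.ne) (fun i => x i - 1) two_pos
    rw [HasFiniteIntegral, ← setLAverage_mul_volume (volume_cube_ne_zero _ two_pos)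
      (volume_cube_ne_top _ _)]
    exact (ENNReal.mul_ne_top h (volume_cube_ne_top _ _)).lt_top

theorem ae_summable_sparse (hn : 1 ≤ n) (hD : IsDyadicGrid D) {S : Set (Set (Fin n → ℝ))}
    (hS : S ⊆ D) (hsp : IsSparse S) {p : ℝ} (hp : 1 ≤ p) {w : (Fin n → ℝ) → ℝ} (hw : MemAp p w)
    {f : (Fin n → ℝ) → ℝ} (hf : MemLp f (ENNReal.ofReal p) volume) :
    ∀ᵐ x, Summable fun Q : S => (Q : Set (Fin n → ℝ)).indicator
      (fun _ => |⨍ y in (Q : Set (Fin n → ℝ)), f y * w y ^ (-(1 / p))|) x := by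
  have hp0 : 0 < p := by linarith
  have hgm : AEMeasurable (fun y => f y * w y ^ (-(1 / p))) volume :=
    hf.1.aemeasurable.mul (hw.1.1.aestronglyMeasurable.aemeasurable.pow_const _)
  filter_upwards [ae_tsum_setLAverage_ne_top hn hD hS hsp hp hw hgm.enorm (by
      rw [lintegral_congr_ae (ae_enorm_mul_rpow_eq hp hw.1 f), ← eLpNorm_rpow_eq hp]
      exact ENNReal.rpow_ne_top_of_nonneg hp0.le hf.2.ne)] with x hx
  have hx' : ∑' Q : S, ENNReal.ofReal ((Q : Set (Fin n → ℝ)).indicator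
      (fun _ => |⨍ y in (Q : Set (Fin n → ℝ)), f y * w y ^ (-(1 / p))|) x) ≠ ∞ := by
    refine ne_top_of_le_ne_top hx (ENNReal.tsum_le_tsum fun Q => ?_)
    by_cases hxQ : x ∈ (Q : Set (Fin n → ℝ))
    · rw [indicator_of_mem hxQ, indicator_of_mem hxQ, ← Real.enorm_eq_ofReal_abs]
      exact enorm_setAverage_le _ _
    · rw [indicator_of_notMem hxQ, indicator_of_notMem hxQ, ENNReal.ofReal_zero]
  refine (ENNReal.summable_toReal hx').congr fun Q => ?_
  exact ENNReal.toReal_ofReal (indicator_nonneg (fun _ _ => abs_nonneg _) x)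

end SparseWeak

end

theorem theorem3p1 (n : ℕ) (hn : 1 ≤ n) (p : ℝ) (hp : 1 ≤ p) :
    ∃ C : ℝ≥0, ∀ D S : Set (Set (Fin n → ℝ)),
      SparseWeak.IsDyadicGrid D → S ⊆ D → SparseWeak.IsSparse S →
      ∀ w : (Fin n → ℝ) → ℝ, SparseWeak.MemAp p w →
      ∀ f : (Fin n → ℝ) → ℝ, MemLp f (ENNReal.ofReal p) volume →
        LocallyIntegrable (fun y => f y * w y ^ (-(1 / p))) volume ∧
        (∀ᵐ x, Summable fun Q : S => (Q : Set (Fin n → ℝ)).indicator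
          (fun _ => |⨍ y in (Q : Set (Fin n → ℝ)), f y * w y ^ (-(1 / p))|) x) ∧
        ∀ t : ℝ, 0 < t →
          volume {x | t < |w x ^ (1 / p) *
              SparseWeak.sparseOp S (fun y => f y * w y ^ (-(1 / p))) x|} ≤
            C * SparseWeak.apConst p w * SparseWeak.ainftyConst w ^ p *
              (eLpNorm f (ENNReal.ofReal p) volume / ENNReal.ofReal t) ^ p :=
  ⟨SparseWeak.weakConst n p, fun _ _ hD hS hsp _ hw _ hf =>
    ⟨SparseWeak.locallyIntegrable_mul_rpow hp hw hf,
      SparseWeak.ae_summable_sparse hn hD hS hsp hp hw hf,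
      fun _ ht => SparseWeak.volume_lt_sparseOp_le hD hS hsp hp hw hf.1 ht⟩⟩
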